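/- Let $p\ge 2$ be an integer and $\mathbb P=\{1,\dots,p-1\}$. Let $G$ be the Vilenkin group: the sequences $x=(x_j)_{j\in\mathbb Z}$ with $x_j\in\{0,\dots,p-1\}$ and $x_j=0$ for all sufficiently negative $j$, with coordinatewise addition $\oplus$ modulo $p$ (subtraction $\ominus$, identity $\theta$), and with the topology with base $x\oplus\rho^m(U)$ ($x\in G$, $m\in\mathbb Z$), where $(\rho(x))_j=x_{j+1}$, $\sigma=\rho^{-1}$, and $U=\{x: x_j=0\text{ for } j\le 0\}$. The dual group $G^*$ is the same group of sequences, acting on $G$ by the characters $\chi(x,\omega)=\exp\big(\tfrac{2\pi i}{p}\sum_{j\in\mathbb Z}x_j\omega_{1-j}\big)$; $\mu$ and $\mu^*$ are the Haar measures of $G$ and $G^*$ with $\mu(U)=\mu^*(U)=1$. The Fourier transform is $\widehat f(\omega)=\int_G f(x)\overline{\chi(x,\omega)}\,d\mu(x)$ on $L^1(G)\cap L^2(G)$, extended by continuity to $L^2(G)$, with inverse $f\mapsto f^\vee$. Let $\Lambda$ be the subgroup of sequences with $x_j=0$ for $j>0$ (in $G$ and in $G^*$), and write $f_{j,n}(x)=p^{j/2}f(\rho^j(x)\ominus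 n)$ for $j\in\mathbb Z$, $n\in\Lambda$. An MRA of $L^2(G)$ is an increasing sequence $(V_j)_{j\in\mathbb Z}$ of closed subspaces of $L^2(G)$ such that $\bigcup_j V_j$ is dense, $\bigcap_j V_j=\{0\}$, $f\in V_j\iff f(\rho\,\cdot)\in V_{j+1}$, $f\in V_0\iff f(\cdot\ominus n)\in V_0$ for all $n\in\Lambda$, and there is $\varphi\in L^2(G)$ (a scaling function) whose translates $\varphi(\cdot\ominus n)$, $n\in\Lambda$, form a Riesz basis of $V_0$. A family $\{\psi^{(u)}\}_{u\in\mathbb P}\subset L^2(G)$ is associated with (comes from) the MRA if, for every $j\in\mathbb Z$, $\{\psi^{(u)}_{j,n}\}_{n\in\Lambda,u\in\mathbb P}$ is an orthonormal basis of the orthogonal complement of $V_j$ in $V_{j+1}$. Let $\Omega=\{\Omega^{(u)}\}_{u\in\mathbb P}$ be a wavelet set, that is, a family of measurable subsets of $G^*$ of finite measure such that $\{((\mathbf 1_{\Omega^{(u)}})^\vee)_{j,n}\}_{j\in\mathbb Z,n\in\Lambda,u\in\mathbb P}$ is an orthonormal basis of $L^2(G)$, and let $\psi^{(u)}\in L^2(G)$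 with $\widehat{\psi^{(u)}}=\mathbf 1_{\Omega^{(u)}}$. Put $\Omega_\Sigma=\bigcup_{u\in\mathbb P}\bigcup_{j\ge 1}\sigma^j(\Omega^{(u)})$. Then $\{\psi^{(u)}\}_{u\in\mathbb P}$ is associated with an MRA if and only if $\mu^*\big(\Omega_\Sigma\cap(\Omega_\Sigma\oplus n)\big)$ equals $1$ for $n=\theta$ and $0$ for every $n\in\Lambda\setminus\{\theta\}$. Moreover, for every MRA $(V_j)$ with which $\{\psi^{(u)}\}$ is associated, the function $\varphi\in L^2(G)$ with $\widehat\varphi=\mathbf 1_{\Omega_\Sigma}$ is a scaling function, and its translates $\{\varphi(\cdot\ominus n)\}_{n\in\Lambda}$ even form an orthonormal basis of $V_0$. -/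

import Mathlib

open MeasureTheory Filter Topology

noncomputable section

/-- The Vilenkin group `G`: sequences `(x_j)_{j ∈ ℤ}` of digits modulo `p` that vanish for all
sufficiently negative `j`. -/
@[ext] structure Vilenkin (p : ℕ) : Type where
  digit : ℤ → ZMod p
  vanish : ∃ k : ℤ, ∀ j < k, digit j = 0

/-- The dual group `G*`, realised as the same group of sequences; the duality is given by
`Vilenkin.chi`. -/
abbrev VilenkinDual (p : ℕ) : Type := Vilenkin p

namespace Vilenkin

variable {p : ℕ}

instance : CoeFun (Vilenkin p) (fun _ => ℤ → ZMod p) := ⟨digit⟩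

instance : Zero (Vilenkin p) := ⟨⟨fun _ => 0, 0, fun _ _ => rfl⟩⟩

/-- Coordinatewise addition modulo `p`. -/
instance : Add (Vilenkin p) := ⟨fun x y => ⟨fun j => x j + y j, by
  obtain ⟨k, hk⟩ := x.vanish
  obtain ⟨l, hl⟩ := y.vanish
  refine ⟨min k l, fun j hj => ?_⟩
  simp [hk j (lt_of_lt_of_le hj (min_le_left _ _)), hl j (lt_of_lt_of_le hj (min_le_right _ _))]⟩⟩

instance : Neg (Vilenkin p) := ⟨fun x => ⟨fun j => -x j, by
  obtain ⟨k, hk⟩ := x.vanish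
  exact ⟨k, fun j hj => by simp [hk j hj]⟩⟩⟩

@[simp] theorem zero_apply (j : ℤ) : (0 : Vilenkin p) j = 0 := rfl

@[simp] theorem add_apply (x y : Vilenkin p) (j : ℤ) : (x + y) j = x j + y j := rfl

@[simp] theorem neg_apply (x : Vilenkin p) (j : ℤ) : (-x) j = -x j := rfl

theorem ext' {x y : Vilenkin p} (h : ∀ j, x j = y j) : x = y := Vilenkin.ext (funext h)

instance : AddCommGroup (Vilenkin p) where
  add_assoc x y z := ext' fun j => by simp [add_assoc]
  zero_add x := ext' fun j => by simp
  add_zero x := ext' fun j => by simp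
  neg_add_cancel x := ext' fun j => by simp
  add_comm x y := ext' fun j => by simp [add_comm]
  nsmul := nsmulRec
  zsmul := zsmulRec

/-- The `m`-th power `ρ^m` (`m ∈ ℤ`) of the dilation `(ρ x)_j = x_{j+1}`. In particular
`dil 1 = ρ`, and `dil (-m) = σ^m` for `σ = ρ⁻¹`, `(σ x)_j = x_{j-1}`. -/
def dil (m : ℤ) (x : Vilenkin p) : Vilenkin p :=
  ⟨fun j => x (j + m), by
    obtain ⟨k, hk⟩ := x.vanish
    exact ⟨k - m, fun j hj => hk _ (by linarith)⟩⟩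

@[simp] theorem dil_apply (m : ℤ) (x : Vilenkin p) (j : ℤ) : dil m x j = x (j + m) := rfl

/-- The subgroup `U` of sequences supported on the positive indices. -/
def U (p : ℕ) : Set (Vilenkin p) := {x | ∀ j : ℤ, j ≤ 0 → x j = 0}

/-- `U_m = ρ^m(U)`. -/
def UPow (p : ℕ) (m : ℤ) : Set (Vilenkin p) := dil m '' U p

theorem mem_UPow {m : ℤ} {x : Vilenkin p} : x ∈ UPow p m ↔ ∀ j : ℤ, j ≤ -m → x j = 0 := by
  constructor
  · rintro ⟨y, hy, rfl⟩ j hj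
    exact hy _ (by linarith)
  · intro h
    refine ⟨dil (-m) x, fun j hj => h _ (by linarith), ?_⟩
    exact ext' fun j => by simp

/-- The topology of `G`, with base the sets `x + U_m`. -/
instance : TopologicalSpace (Vilenkin p) :=
  TopologicalSpace.generateFrom
    {s | ∃ (x : Vilenkin p) (m : ℤ), s = (fun y => x + y) '' UPow p m}

theorem mem_coset {x y : Vilenkin p} {m : ℤ} :
    y ∈ (fun z => x + z) '' UPow p m ↔ ∀ j : ℤ, j ≤ -m → y j = x j := by
  constructor
  · rintro ⟨z, hz, rfl⟩ j hj
    simp [mem_UPow.1 hz j hj]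
  · intro h
    refine ⟨-x + y, mem_UPow.2 fun j hj => ?_, ?_⟩
    · simp [h j hj]
    · simp

theorem isOpen_coset (x : Vilenkin p) (m : ℤ) : IsOpen ((fun z => x + z) '' UPow p m) :=
  TopologicalSpace.isOpen_generateFrom_of_mem ⟨x, m, rfl⟩

instance : IsTopologicalAddGroup (Vilenkin p) where
  continuous_add := by
    refine continuous_generateFrom_iff.2 ?_
    rintro _ ⟨x, m, rfl⟩
    rw [isOpen_iff_forall_mem_open]
    rintro ⟨a, b⟩ hab
    refine ⟨((fun z => a + z) '' UPow p m) ×ˢ ((fun z => b + z) '' UPow p m), ?_,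
      (isOpen_coset a m).prod (isOpen_coset b m), ?_⟩
    · rintro ⟨c, d⟩ ⟨hc, hd⟩
      refine mem_coset.2 fun j hj => ?_
      have h := mem_coset.1 hab j hj
      simp only [add_apply] at h ⊢
      rw [mem_coset.1 hc j hj, mem_coset.1 hd j hj, h]
    · exact ⟨mem_coset.2 fun _ _ => rfl, mem_coset.2 fun _ _ => rfl⟩
  continuous_neg := by
    refine continuous_generateFrom_iff.2 ?_
    rintro _ ⟨x, m, rfl⟩
    rw [isOpen_iff_forall_mem_open]
    intro a ha
    refine ⟨(fun z => a + z) '' UPow p m, fun c hc => mem_coset.2 fun j hj => ?_,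
      isOpen_coset a m, mem_coset.2 fun _ _ => rfl⟩
    have h := mem_coset.1 ha j hj
    simp only [neg_apply] at h ⊢
    rw [mem_coset.1 hc j hj, h]

/-- The Borel σ-algebra. -/
instance : MeasurableSpace (Vilenkin p) := borel _

instance : BorelSpace (Vilenkin p) := ⟨rfl⟩

theorem U_eq_coset : U p = (fun z => (0 : Vilenkin p) + z) '' UPow p 0 := by
  ext x
  rw [mem_coset]
  simp [U]

theorem isOpen_U : IsOpen (U p) := by
  rw [U_eq_coset]
  exact isOpen_coset 0 0

theorem isCompact_U [NeZero p] : IsCompact (U p) := by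
  let e : (ℕ → Fin p) → Vilenkin p := fun a =>
    ⟨fun j => if j ≤ 0 then 0 else ((a (j - 1).toNat : ℕ) : ZMod p),
      ⟨0, fun j hj => if_pos hj.le⟩⟩
  have he : ∀ (a : ℕ → Fin p) (j : ℤ),
      e a j = if j ≤ 0 then 0 else ((a (j - 1).toNat : ℕ) : ZMod p) := fun _ _ => rfl
  have hc : Continuous e := by
    refine continuous_generateFrom_iff.2 ?_
    rintro _ ⟨x, m, rfl⟩
    rw [isOpen_iff_forall_mem_open]
    intro a ha
    refine ⟨Set.pi (Finset.range (-m).toNat : Set ℕ) (fun i => {a i}), ?_,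
      isOpen_set_pi (Finset.finite_toSet _) (fun _ _ => isOpen_discrete _), fun _ _ => rfl⟩
    intro b hb
    refine mem_coset.2 fun j hj => ?_
    rw [← mem_coset.1 ha j hj, he, he]
    split_ifs with h
    · rfl
    · have hb' : b (j - 1).toNat = a (j - 1).toNat := hb _ (by simp; omega)
      rw [hb']
  have hU : U p = Set.range e := by
    ext x
    constructor
    · intro hx
      let a : ℕ → Fin p := fun i => ⟨(x ((i : ℤ) + 1)).val, ZMod.val_lt _⟩
      refine ⟨a, ext' fun j => ?_⟩
      rw [he a j]
      split_ifs with h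
      · exact (hx j h).symm
      · have : ((j.toNat - 1 : ℕ) : ℤ) + 1 = j := by omega
        simp [a, this]
    · rintro ⟨a, rfl⟩ j hj
      rw [he, if_pos hj]
  rw [hU]
  exact isCompact_range hc

/-- The Haar measure of `G` (and of `G*`), normalised by `μ(U) = 1`. -/
def haar (p : ℕ) [NeZero p] : Measure (Vilenkin p) :=
  Measure.addHaarMeasure
    ⟨⟨U p, isCompact_U⟩, ⟨0, by rw [isOpen_U.interior_eq]; exact fun _ _ => rfl⟩⟩

/-- The discrete subgroup `Λ` of sequences supported on the nonpositive indices. -/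
def lattice (p : ℕ) : AddSubgroup (Vilenkin p) where
  carrier := {x | ∀ j : ℤ, 0 < j → x j = 0}
  zero_mem' := fun _ _ => rfl
  add_mem' := fun {x y} hx hy j hj => by simp [hx j hj, hy j hj]
  neg_mem' := fun {x} hx j hj => by simp [hx j hj]

/-- The characters `χ(x, ω) = exp ((2πi / p) ∑_j x_j ω_{1-j})`; the sum has finitely many nonzero
terms, and `ZMod.stdAddChar` is `a ↦ exp (2πi a / p)` on `ℤ / p`. -/
def chi [NeZero p] (x : Vilenkin p) (ω : VilenkinDual p) : ℂ :=
  ZMod.stdAddChar (∑ᶠ j : ℤ, x j * ω (1 - j))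

/-- The index set `{1, …, p - 1}`. -/
abbrev Idx (p : ℕ) : Type := ↥(Finset.Icc 1 (p - 1))

/-- `Ω_Σ = ⋃_u ⋃_{j ≥ 1} σ^j(Ω^{(u)})`. -/
def sigmaUnion (Ω : Idx p → Set (VilenkinDual p)) : Set (VilenkinDual p) :=
  ⋃ u : Idx p, ⋃ j : ℕ, ⋃ _ : 1 ≤ j, dil (-(j : ℤ)) '' Ω u

variable [NeZero p]

/-- The Hilbert space `L²(G)`. -/
abbrev L2 (p : ℕ) [NeZero p] : Type := Lp ℂ 2 (haar p)

/-- The integral defining the Fourier transform of integrable functions. -/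
def fourierIntegral (f : Vilenkin p → ℂ) (ω : VilenkinDual p) : ℂ :=
  ∫ x, f x * (starRingEnd ℂ) (chi x ω) ∂(haar p)

/-- The integral defining the inverse Fourier transform of integrable functions. -/
def invFourierIntegral (g : VilenkinDual p → ℂ) (x : Vilenkin p) : ℂ :=
  ∫ ω, g ω * chi x ω ∂(haar p)

/-- `g` is (a representative of) the Fourier transform of `f ∈ L²(G)`: the Fourier transform on
`L²(G)` is the extension by continuity of the one on `L¹(G) ∩ L²(G)`. -/
def IsFourierTransform (f : Vilenkin p → ℂ) (g : VilenkinDual p → ℂ) : Prop :=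
  MemLp f 2 (haar p) ∧ MemLp g 2 (haar p) ∧
    ∃ F : ℕ → Vilenkin p → ℂ,
      (∀ k, Integrable (F k) (haar p) ∧ MemLp (F k) 2 (haar p)) ∧
      Tendsto (fun k => eLpNorm (F k - f) 2 (haar p)) atTop (𝓝 0) ∧
      Tendsto (fun k => eLpNorm (fourierIntegral (F k) - g) 2 (haar p)) atTop (𝓝 0)

/-- `f_{j,n}(x) = p^{j/2} f(ρ^j(x) ⊖ n)`. -/
def dilTrans (f : Vilenkin p → ℂ) (j : ℤ) (n : lattice p) : Vilenkin p → ℂ :=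
  fun x => (((p : ℝ) ^ ((j : ℝ) / 2) : ℝ) : ℂ) * f (dil j x - n)

/-- The function `f` belongs to `L²(G)` and its class lies in the subspace `V`. -/
def MemSubspace (V : Submodule ℂ (L2 p)) (f : Vilenkin p → ℂ) : Prop :=
  ∃ h : MemLp f 2 (haar p), h.toLp f ∈ V

/-- The functions `e i` belong to `L²(G)` and form an orthonormal basis of the closed
subspace `V`. -/
def IsOrthonormalBasis {ι : Type} (V : Submodule ℂ (L2 p)) (e : ι → Vilenkin p → ℂ) : Prop :=
  ∃ h : ∀ i, MemLp (e i) 2 (haar p),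
    Orthonormal ℂ (fun i => (h i).toLp (e i)) ∧
    (Submodule.span ℂ (Set.range fun i => (h i).toLp (e i))).topologicalClosure = V

/-- The functions `e i` belong to `L²(G)` and form a Riesz basis of the closed subspace `V`. -/
def IsRieszBasis {ι : Type} (V : Submodule ℂ (L2 p)) (e : ι → Vilenkin p → ℂ) : Prop :=
  ∃ h : ∀ i, MemLp (e i) 2 (haar p),
    (Submodule.span ℂ (Set.range fun i => (h i).toLp (e i))).topologicalClosure = V ∧
    ∃ C C' : ℝ, 0 < C ∧ 0 < C' ∧ ∀ β : lp (fun _ : ι => ℂ) 2,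
      Summable (fun i => β i • (h i).toLp (e i)) ∧
      C * ‖β‖ ≤ ‖∑' i, β i • (h i).toLp (e i)‖ ∧
      ‖∑' i, β i • (h i).toLp (e i)‖ ≤ C' * ‖β‖

/-- `φ` is a scaling function for `(V_j)`: its `Λ`-translates form a Riesz basis of `V_0`. -/
def IsScalingFunction (V : ℤ → Submodule ℂ (L2 p)) (φ : Vilenkin p → ℂ) : Prop :=
  IsRieszBasis (V 0) (fun (n : lattice p) x => φ (x - n))

/-- Multiresolution analyses of `L²(G)`. -/
structure IsMRA (V : ℤ → Submodule ℂ (L2 p)) : Prop where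
  isClosed : ∀ j, IsClosed (V j : Set (L2 p))
  increasing : Monotone V
  dense_iUnion : Dense (⋃ j, (V j : Set (L2 p)))
  iInter_eq : (⋂ j, (V j : Set (L2 p))) = {0}
  dilation : ∀ (j : ℤ) (f : Vilenkin p → ℂ), MemLp f 2 (haar p) →
    (MemSubspace (V j) f ↔ MemSubspace (V (j + 1)) (fun x => f (dil 1 x)))
  translation : ∀ f : Vilenkin p → ℂ, MemLp f 2 (haar p) →
    (MemSubspace (V 0) f ↔ ∀ n : lattice p, MemSubspace (V 0) (fun x => f (x - n)))
  scaling : ∃ φ : Vilenkin p → ℂ, IsScalingFunction V φ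

/-- The family `ψ` is associated with `(V_j)`: for every `j`, the functions `ψ^{(u)}_{j,n}` form an
orthonormal basis of the orthogonal complement `W_j` of `V_j` in `V_{j+1}`. -/
def IsAssociated (ψ : Idx p → Vilenkin p → ℂ) (V : ℤ → Submodule ℂ (L2 p)) : Prop :=
  ∀ j : ℤ, IsOrthonormalBasis (V (j + 1) ⊓ (V j)ᗮ)
    (fun i : lattice p × Idx p => dilTrans (ψ i.2) j i.1)

/-- (Multi)wavelet sets: the functions `((1_{Ω^{(u)}})^∨)_{j,n}` form an orthonormal basis of
`L²(G)`. For `1_{Ω^{(u)}}` to be in `L²(G*)`, the sets have to be of finite measure; the indicators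
are then integrable, and the inverse Fourier transform is given by the integral. -/
def IsWaveletSet (Ω : Idx p → Set (VilenkinDual p)) : Prop :=
  (∀ u, MeasurableSet (Ω u)) ∧ (∀ u, haar p (Ω u) < ⊤) ∧
    IsOrthonormalBasis (⊤ : Submodule ℂ (L2 p))
      (fun i : ℤ × lattice p × Idx p =>
        dilTrans (invFourierIntegral ((Ω i.2.2).indicator fun _ => 1)) i.1 i.2.1)

end Vilenkin

end

/-!
The argument runs on the side of the dual group. The Fourier transform carries `ψ^{(u)}_{j,n}` to a
modulation, times a constant, of the indicator of the *tile* `ρ^j(Ω^{(u)})`. Orthogonality of the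
untranslated wavelets says that the tiles are pairwise almost disjoint (`haar_tile_inter_tile`), and
normalisation says that each `Ω^{(u)}` has measure one; hence `Ω_Σ`, the union of the tiles with
`j < 0`, has measure `(p - 1) ∑_{j ≥ 1} p^{-j} = 1` (`haar_sigmaUnion`).

Let `ladder m` be the space of all `f` orthogonal to the wavelets of index `j ≥ m`. Together with
its wavelets it satisfies all requirements of an MRA except the existence of a scaling function, and
conversely every MRA with which the wavelets are associated has `ladder 0` as its central space,
because both spaces are the closed span of the wavelets with `j < 0` (`eq_ladder_of_isAssociated`).
Completeness of the wavelets shows that the Fourier image of `ladder 0` is the space `L²(Ω_Σ)` of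
functions that vanish off `Ω_Σ` (`mem_ladder_zero_iff`). What is left is the question when `L²(Ω_Σ)`
is generated by the modulations `χ(n, ·) G`, `n ∈ Λ`, of one function.

* If it is, then the translates of `Ω_Σ` by `Λ` are almost disjoint
  (`haar_sigmaUnion_inter_translate`): for `B ⊆ Ω_Σ ∩ (Ω_Σ + k)` inside one coset of `U`, the
  function `1_B conj G(· - k) - 1_{B - k} conj G(· + k)` lies in `L²(Ω_Σ)` and is orthogonal to all
  these modulations, since they are `Λ`-periodic multiples of `G`. So it vanishes, `G` vanishes on
  `B`, the function `1_B` is also orthogonal to all modulations, and `B` is null.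
* If the translates are almost disjoint, then `Ω_Σ`, being of measure one, is a fundamental domain
  of `Λ`, like `U`. So the functions `χ(n, ·) 1_{Ω_Σ}` are orthonormal, and they are complete in
  `L²(Ω_Σ)` by uniqueness for Fourier series (`ae_eq_zero_of_integral_mul_chi_eq_zero`).

The Plancherel theorem for `G` is obtained from the Gabor basis: the functions `χ(·, k) 1_{U + n}`,
with `n` and `k` in `Λ`, are an orthonormal basis of `L²(G)`, and the Fourier integral maps the
atom `(n, k)` to the atom `(k, -n)`. The resulting unitary operator `fourierL2` agrees with the
Fourier integral on `L¹ ∩ L²` by the multiplication formula, and hence with the relation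
`IsFourierTransform` (`isFourierTransform_iff`).
-/

namespace Vilenkin

variable {p : ℕ}

/-! ### Topology and Haar measure -/

/-- The sequences that agree with `x` at all indices `≤ N`, i.e. the coset `x + U_{-N}`. -/
def cyl (x : Vilenkin p) (N : ℤ) : Set (Vilenkin p) := {y | ∀ j ≤ N, y j = x j}

theorem cyl_eq_coset (x : Vilenkin p) (N : ℤ) :
    cyl x N = (fun z => x + z) '' UPow p (-N) := by
  ext y
  rw [mem_coset, neg_neg]
  rfl

theorem isOpen_cyl (x : Vilenkin p) (N : ℤ) : IsOpen (cyl x N) := by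
  rw [cyl_eq_coset]
  exact isOpen_coset x _

theorem mem_cyl_self (x : Vilenkin p) (N : ℤ) : x ∈ cyl x N := fun _ _ => rfl

theorem cyl_mem_nhds (x : Vilenkin p) (N : ℤ) : cyl x N ∈ 𝓝 x :=
  (isOpen_cyl x N).mem_nhds (mem_cyl_self x N)

theorem measurableSet_cyl (x : Vilenkin p) (N : ℤ) : MeasurableSet (cyl x N) :=
  (isOpen_cyl x N).measurableSet

theorem cyl_eq_of_mem {x y : Vilenkin p} {N : ℤ} (h : y ∈ cyl x N) : cyl y N = cyl x N := by
  ext z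
  exact ⟨fun hz j hj => (hz j hj).trans (h j hj), fun hz j hj => (hz j hj).trans (h j hj).symm⟩

theorem measurableSet_U : MeasurableSet (U p) := isOpen_U.measurableSet

/-- The family of all cosets `x + U_m`, written as cylinders. -/
def cylinders (p : ℕ) : Set (Set (Vilenkin p)) := {s | ∃ x N, s = cyl x N}

theorem topology_eq_generateFrom_cylinders :
    (inferInstance : TopologicalSpace (Vilenkin p)) =
      TopologicalSpace.generateFrom (cylinders p) := by
  have h : cylinders p = {s | ∃ (x : Vilenkin p) (m : ℤ), s = (fun y => x + y) '' UPow p m} := by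
    ext s
    constructor
    · rintro ⟨x, N, rfl⟩
      exact ⟨x, -N, cyl_eq_coset x N⟩
    · rintro ⟨x, m, rfl⟩
      exact ⟨x, -m, by rw [cyl_eq_coset, neg_neg]⟩
  rw [h]
  rfl

/-- The sequence with the single digit `t` at the index `i`. -/
def single (i : ℤ) (t : ZMod p) : Vilenkin p :=
  ⟨fun j => if j = i then t else 0, i, fun _ hj => if_neg hj.ne⟩

@[simp] theorem single_apply_self (i : ℤ) (t : ZMod p) : single i t i = t := if_pos rfl

theorem single_apply_of_ne {i j : ℤ} (h : j ≠ i) (t : ZMod p) : single i t j = 0 :=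
  if_neg h

/-- A finitely supported sequence as an element of the Vilenkin group. -/
def ofFinsupp (f : ℤ →₀ ZMod p) : Vilenkin p :=
  ⟨f, by
    obtain ⟨k, hk⟩ := f.support.bddBelow
    refine ⟨k, fun j hj => ?_⟩
    by_contra h
    exact absurd (hk (Finsupp.mem_support_iff.2 h)) (not_le.2 hj)⟩

theorem exists_ofFinsupp_mem_cyl (x : Vilenkin p) (N : ℤ) :
    ∃ f : ℤ →₀ ZMod p, ofFinsupp f ∈ cyl x N := by
  obtain ⟨k, hk⟩ := x.vanish
  refine ⟨Finsupp.ofSupportFinite (fun j => if j ≤ N then x j else 0)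
    ((Set.finite_Icc k N).subset fun j hj => ?_), fun j hj => if_pos hj⟩
  by_contra h
  refine hj ?_
  by_cases h1 : j ≤ N
  · simp only [h1, if_true]
    exact hk j (by simp only [Set.mem_Icc, not_and_or, not_le] at h; omega)
  · simp [h1]

theorem isPiSystem_cylinders : IsPiSystem (cylinders p) := by
  rintro _ ⟨x, N, rfl⟩ _ ⟨y, M, rfl⟩ ⟨z, hzx, hzy⟩
  rw [← cyl_eq_of_mem hzx, ← cyl_eq_of_mem hzy]
  refine ⟨z, max N M, Set.ext fun w => ⟨fun h j hj => ?_,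
    fun h => ⟨fun j hj => ?_, fun j hj => ?_⟩⟩⟩
  · rcases le_max_iff.1 hj with h' | h'
    exacts [h.1 j h', h.2 j h']
  · exact h j (hj.trans (le_max_left _ _))
  · exact h j (hj.trans (le_max_right _ _))

section

variable [NeZero p]

theorem countable_cylinders : (cylinders p).Countable := by
  refine (Set.countable_range fun q : (ℤ →₀ ZMod p) × ℤ => cyl (ofFinsupp q.1) q.2).mono ?_
  rintro _ ⟨x, N, rfl⟩
  obtain ⟨f, hf⟩ := exists_ofFinsupp_mem_cyl x N
  exact ⟨(f, N), cyl_eq_of_mem hf⟩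

instance : SecondCountableTopology (Vilenkin p) :=
  ⟨cylinders p, countable_cylinders, topology_eq_generateFrom_cylinders⟩

theorem borel_eq_generateFrom_cylinders :
    (inferInstance : MeasurableSpace (Vilenkin p)) =
      MeasurableSpace.generateFrom (cylinders p) :=
  borel_eq_generateFrom_of_subbasis topology_eq_generateFrom_cylinders

instance : LocallyCompactSpace (Vilenkin p) :=
  TopologicalSpace.PositiveCompacts.locallyCompactSpace_of_addGroup
    (⟨⟨U p, isCompact_U⟩, ⟨0, by rw [isOpen_U.interior_eq]; exact fun _ _ => rfl⟩⟩ :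
      TopologicalSpace.PositiveCompacts (Vilenkin p))

instance : (haar p).IsAddHaarMeasure := by
  unfold haar
  infer_instance

theorem haar_U : haar p (U p) = 1 :=
  Measure.addHaarMeasure_self (K₀ := ⟨⟨U p, isCompact_U⟩,
    ⟨0, by rw [isOpen_U.interior_eq]; exact fun _ _ => rfl⟩⟩)

end

/-! ### Dilations -/

theorem dil_add (m : ℤ) (x y : Vilenkin p) : dil m (x + y) = dil m x + dil m y := rfl

theorem dil_dil (m k : ℤ) (x : Vilenkin p) : dil m (dil k x) = dil (m + k) x :=
  ext' fun j => by simp [add_assoc]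

@[simp] theorem dil_zero_index (x : Vilenkin p) : dil 0 x = x := ext' fun j => by simp

@[simp] theorem dil_neg_dil (m : ℤ) (x : Vilenkin p) : dil (-m) (dil m x) = x := by
  simp [dil_dil]

@[simp] theorem dil_dil_neg (m : ℤ) (x : Vilenkin p) : dil m (dil (-m) x) = x := by
  simp [dil_dil]

theorem continuous_dil (m : ℤ) : Continuous (dil m : Vilenkin p → Vilenkin p) := by
  refine continuous_generateFrom_iff.2 ?_
  rintro _ ⟨x, N, rfl⟩
  obtain ⟨N, rfl⟩ := neg_surjective N
  rw [← cyl_eq_coset]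
  convert isOpen_cyl (dil (-m) x) (N + m) using 1
  ext y
  constructor
  · intro h j hj
    simpa [sub_eq_add_neg] using h (j - m) (by omega)
  · intro h j hj
    simpa using h (j + m) (by omega)

/-- The dilation `ρ^m` as an automorphism of the topological group. -/
def dilEquiv (p : ℕ) (m : ℤ) : Vilenkin p ≃+ Vilenkin p where
  toFun := dil m
  invFun := dil (-m)
  left_inv := dil_neg_dil m
  right_inv := dil_dil_neg m
  map_add' := dil_add m

theorem dil_image_eq_preimage (m : ℤ) (s : Set (Vilenkin p)) : dil m '' s = dil (-m) ⁻¹' s :=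
  congrFun (Set.image_eq_preimage_of_inverse (dil_neg_dil m) (dil_dil_neg m)) s

theorem measurable_dil (m : ℤ) : Measurable (dil m : Vilenkin p → Vilenkin p) :=
  (continuous_dil m).measurable

theorem measurableEmbedding_dil (m : ℤ) :
    MeasurableEmbedding (dil m : Vilenkin p → Vilenkin p) where
  injective := (dilEquiv p m).injective
  measurable := measurable_dil m
  measurableSet_image' {s} hs := by
    rw [dil_image_eq_preimage]
    exact measurable_dil _ hs

variable [NeZero p]

/-- `ρ(U)` is the disjoint union of `p` translates of `U`. -/
theorem haar_dil_one_image_U : haar p (dil 1 '' U p) = p := by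
  have h : dil 1 '' U p = ⋃ t : ZMod p, (fun x => -single 0 t + x) ⁻¹' U p := by
    rw [dil_image_eq_preimage]
    ext x
    simp only [Set.mem_preimage, Set.mem_iUnion]
    constructor
    · intro hx
      refine ⟨x 0, fun j hj => ?_⟩
      rcases hj.lt_or_eq with h | rfl
      · have := hx (j + 1) (by omega)
        simp only [dil_apply] at this
        simpa [single_apply_of_ne h.ne] using this
      · simp
    · rintro ⟨t, ht⟩ j hj
      have := ht (j + -1) (by omega)
      simpa [single_apply_of_ne (show j + -1 ≠ 0 by omega)] using this
  rw [h, measure_iUnion]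
  · simp [measure_preimage_add, haar_U]
  · intro s t hst
    refine Set.disjoint_left.2 fun x hs ht => hst ?_
    have h1 := hs 0 le_rfl
    have h2 := ht 0 le_rfl
    simp only [add_apply, neg_apply, single_apply_self] at h1 h2
    rw [neg_add_eq_zero] at h1 h2
    exact h1.trans h2.symm
  · intro t
    exact (measurable_const_add _) measurableSet_U

theorem isAddHaarMeasure_map_dil (m : ℤ) : ((haar p).map (dil m)).IsAddHaarMeasure :=
  (dilEquiv p m).isAddHaarMeasure_map (haar p) (continuous_dil m) (continuous_dil (-m))

/-- By uniqueness of the Haar measure, the dilation changes it by a constant, which is found by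
evaluating at `U`. -/
theorem map_dil_neg_one : (haar p).map (dil (-1)) = (p : ENNReal) • haar p := by
  have := isAddHaarMeasure_map_dil (p := p) (-1)
  have h := Measure.isAddLeftInvariant_eq_smul ((haar p).map (dil (-1))) (haar p)
  have h2 := congrArg (fun ν : Measure (Vilenkin p) => ν (U p)) h
  simp only [Measure.map_apply (measurable_dil (p := p) (-1)) measurableSet_U,
    ← dil_image_eq_preimage, Measure.smul_apply, haar_dil_one_image_U, haar_U,
    ENNReal.smul_def, smul_eq_mul, mul_one] at h2
  rw [h, h2]
  rfl

theorem natCast_ne_zero : (p : ENNReal) ≠ 0 := by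
  exact_mod_cast NeZero.ne p

theorem map_dil_one : (haar p).map (dil 1) = (p : ENNReal)⁻¹ • haar p := by
  have h : ((haar p).map (dil (-1))).map (dil 1) = haar p := by
    rw [Measure.map_map (measurable_dil _) (measurable_dil _)]
    convert Measure.map_id
    funext x
    simp
  rw [map_dil_neg_one, Measure.map_smul] at h
  nth_rewrite 2 [← h]
  rw [smul_smul, ENNReal.inv_mul_cancel natCast_ne_zero (ENNReal.natCast_ne_top p), one_smul]

theorem natCast_zpow_eq_ofReal (m : ℤ) : (p : ENNReal) ^ m = ENNReal.ofReal ((p : ℝ) ^ m) := by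
  have hp : (0 : ℝ) < p := by exact_mod_cast Nat.pos_of_ne_zero (NeZero.ne p)
  rw [← ENNReal.rpow_intCast, ← Real.rpow_intCast, ← ENNReal.ofReal_rpow_of_pos hp,
    ENNReal.ofReal_natCast]

/-- The push-forward form of the fact that `ρ^m` multiplies the measure of a set by `p^m`. -/
theorem map_dil (m : ℤ) : (haar p).map (dil m) = (p : ENNReal) ^ (-m) • haar p := by
  have hp := natCast_ne_zero (p := p)
  have hp' := ENNReal.natCast_ne_top p
  have key (a b : ℤ) : (haar p).map (dil (a + b)) = ((haar p).map (dil b)).map (dil a) := by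
    rw [Measure.map_map (measurable_dil _) (measurable_dil _)]
    congr 1
    funext x
    simp [dil_dil]
  induction m using Int.induction_on with
  | zero =>
    simp only [neg_zero, zpow_zero, one_smul]
    convert Measure.map_id
    funext x
    simp
  | succ n ih =>
    rw [key, map_dil_one, Measure.map_smul, ih, smul_smul, neg_add,
      ENNReal.zpow_add hp hp', mul_comm, zpow_neg_one]
  | pred n ih =>
    rw [sub_eq_add_neg, key, map_dil_neg_one, Measure.map_smul, ih, smul_smul, neg_add, neg_neg 1,
      ENNReal.zpow_add hp hp', mul_comm, zpow_one]

theorem haar_preimage_dil (m : ℤ) (s : Set (Vilenkin p)) :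
    haar p (dil m ⁻¹' s) = (p : ENNReal) ^ (-m) * haar p s := by
  rw [← (measurableEmbedding_dil m).map_apply, map_dil]
  rfl

theorem haar_image_dil (m : ℤ) (s : Set (Vilenkin p)) :
    haar p (dil m '' s) = (p : ENNReal) ^ m * haar p s := by
  rw [dil_image_eq_preimage, haar_preimage_dil, neg_neg]

theorem quasiMeasurePreserving_dil (m : ℤ) :
    Measure.QuasiMeasurePreserving (dil m) (haar p) (haar p) := by
  refine ⟨measurable_dil m, ?_⟩
  rw [map_dil]
  exact Measure.smul_absolutelyContinuous

theorem integral_comp_dil (m : ℤ) (f : Vilenkin p → ℂ) :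
    ∫ x, f (dil m x) ∂haar p = ((p : ℝ) ^ (-m) : ℝ) * ∫ x, f x ∂haar p := by
  rw [← (measurableEmbedding_dil m).integral_map, map_dil, integral_smul_measure,
    natCast_zpow_eq_ofReal, ENNReal.toReal_ofReal (by positivity), Complex.real_smul]

theorem eLpNorm_comp_dil (m : ℤ) (f : Vilenkin p → ℂ) :
    eLpNorm (fun x => f (dil m x)) 2 (haar p) =
      ENNReal.ofReal ((p : ℝ) ^ (-(m : ℝ) / 2)) * eLpNorm f 2 (haar p) := by
  have h := (measurableEmbedding_dil (p := p) m).eLpNorm_map_measure (g := f) (p := 2)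
    (μ := haar p)
  rw [map_dil, eLpNorm_smul_measure_of_ne_top (by norm_num)] at h
  have h2 : (f ∘ dil m) = fun x => f (dil m x) := rfl
  rw [← h2, ← h, smul_eq_mul]
  congr 1
  have hp : (0 : ℝ) < p := by exact_mod_cast Nat.pos_of_ne_zero (NeZero.ne p)
  rw [← ENNReal.rpow_intCast, ← ENNReal.rpow_mul, ← ENNReal.ofReal_rpow_of_pos hp,
    ENNReal.ofReal_natCast]
  congr 1
  simp [div_eq_mul_inv]

end Vilenkin

namespace Vilenkin

variable {p : ℕ}

/-! ### The lattice `Λ` -/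

theorem mem_U {x : Vilenkin p} : x ∈ U p ↔ ∀ j : ℤ, j ≤ 0 → x j = 0 := Iff.rfl

/-- The part of a sequence supported on the nonpositive indices. -/
def intPart (x : Vilenkin p) : lattice p :=
  ⟨⟨fun j => if j ≤ 0 then x j else 0, by
    obtain ⟨k, hk⟩ := x.vanish
    exact ⟨k, fun j hj => by simp [hk j hj]⟩⟩, fun _ hj => if_neg (not_le.2 hj)⟩

/-- The part of a sequence supported on the positive indices. -/
def fracPart (x : Vilenkin p) : Vilenkin p :=
  ⟨fun j => if j ≤ 0 then 0 else x j, ⟨0, fun _ hj => if_pos hj.le⟩⟩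

theorem intPart_apply (x : Vilenkin p) (j : ℤ) :
    (intPart x : Vilenkin p) j = if j ≤ 0 then x j else 0 := rfl

theorem fracPart_apply (x : Vilenkin p) (j : ℤ) : fracPart x j = if j ≤ 0 then 0 else x j := rfl

theorem sub_apply (x y : Vilenkin p) (j : ℤ) : (x - y) j = x j - y j := by
  rw [sub_eq_add_neg, add_apply, neg_apply, sub_eq_add_neg]

theorem continuous_fracPart : Continuous (fracPart : Vilenkin p → Vilenkin p) := by
  refine continuous_generateFrom_iff.2 ?_
  rintro _ ⟨z, N, rfl⟩
  obtain ⟨N, rfl⟩ := neg_surjective N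
  rw [← cyl_eq_coset, isOpen_iff_mem_nhds]
  intro x hx
  filter_upwards [cyl_mem_nhds x N] with y hy j hj
  rw [← hx j hj, fracPart_apply, fracPart_apply, hy j hj]

theorem fracPart_preimage_cyl (c : Vilenkin p) (N : ℤ) :
    fracPart ⁻¹' cyl (fracPart c) N = {ω | ∀ j : ℤ, 0 < j → j ≤ N → ω j = c j} := by
  ext ω
  constructor
  · intro h j hj hj'
    have := h j hj'
    rwa [fracPart_apply, fracPart_apply, if_neg (by omega), if_neg (by omega)] at this
  · intro h j hj
    rw [fracPart_apply, fracPart_apply]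
    split_ifs with h'
    exacts [rfl, h j (by omega) hj]

theorem sub_intPart (x : Vilenkin p) : x - (intPart x : Vilenkin p) = fracPart x :=
  ext' fun j => by
    rw [sub_apply, intPart_apply, fracPart_apply]
    split_ifs <;> simp

theorem sub_intPart_mem_U (x : Vilenkin p) : x - (intPart x : Vilenkin p) ∈ U p := by
  rw [sub_intPart]
  exact fun j hj => if_pos hj

theorem eq_of_sub_mem_U {x : Vilenkin p} {m n : lattice p} (hm : x - (m : Vilenkin p) ∈ U p)
    (hn : x - (n : Vilenkin p) ∈ U p) : m = n := by
  refine Subtype.ext (ext' fun j => ?_)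
  rcases le_or_gt j 0 with hj | hj
  · have h1 := hm j hj
    have h2 := hn j hj
    rw [sub_apply, sub_eq_zero] at h1 h2
    exact h1.symm.trans h2
  · rw [m.2 j hj, n.2 j hj]

theorem eq_zero_of_mem_lattice_of_mem_U {x : Vilenkin p} (h : x ∈ lattice p) (h' : x ∈ U p) :
    x = 0 := by
  refine ext' fun j => ?_
  rcases le_or_gt j 0 with hj | hj
  exacts [h' j hj, h j hj]

theorem neg_mem_U {x : Vilenkin p} (h : x ∈ U p) : -x ∈ U p := fun j hj => by
  rw [neg_apply, h j hj, neg_zero]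

theorem single_mem_lattice {i : ℤ} (hi : i ≤ 0) (t : ZMod p) : single i t ∈ lattice p :=
  fun _ hj => single_apply_of_ne (hi.trans_lt hj).ne' t

theorem finite_support_of_mem_lattice (n : lattice p) :
    (Function.support (n : Vilenkin p).digit).Finite := by
  obtain ⟨k, hk⟩ := (n : Vilenkin p).vanish
  refine (Set.finite_Icc k 0).subset fun j hj => ?_
  rw [Set.mem_Icc]
  refine ⟨not_lt.1 fun h => hj (hk j h), not_lt.1 fun h => hj (n.2 j h)⟩

instance [NeZero p] : Countable (lattice p) := by
  refine Function.Injective.countable (β := ℤ →₀ ZMod p)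
    (f := fun n => Finsupp.ofSupportFinite _ (finite_support_of_mem_lattice n)) ?_
  intro m n h
  exact Subtype.ext (ext' fun j => DFunLike.congr_fun h j)

/-! ### Characters -/

theorem finite_support_mul (x ω : Vilenkin p) :
    (Function.support fun j : ℤ => x j * ω (1 - j)).Finite := by
  obtain ⟨k, hk⟩ := x.vanish
  obtain ⟨l, hl⟩ := ω.vanish
  refine (Set.finite_Icc k (1 - l)).subset fun j hj => ?_
  rw [Set.mem_Icc]
  refine ⟨not_lt.1 fun h => hj ?_, not_lt.1 fun h => hj ?_⟩
  · simp only
    rw [hk j h, zero_mul]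
  · simp only
    rw [hl (1 - j) (by omega), mul_zero]

variable [NeZero p]

theorem chi_comm (x ω : Vilenkin p) : chi x ω = chi ω x := by
  unfold chi
  congr 1
  rw [← finsum_comp_equiv (Equiv.subLeft (1 : ℤ))]
  refine finsum_congr fun j => ?_
  simp [mul_comm]

theorem chi_add_left (x y ω : Vilenkin p) : chi (x + y) ω = chi x ω * chi y ω := by
  unfold chi
  rw [← AddChar.map_add_eq_mul,
    ← finsum_add_distrib (finite_support_mul x ω) (finite_support_mul y ω)]
  simp [add_mul]

theorem chi_add_right (x ω η : Vilenkin p) : chi x (ω + η) = chi x ω * chi x η := by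
  rw [chi_comm, chi_add_left, chi_comm ω, chi_comm η]

theorem chi_eq_one {x ω : Vilenkin p} (h : ∀ j, x j * ω (1 - j) = 0) : chi x ω = 1 := by
  unfold chi
  simp [h]

@[simp] theorem chi_zero_left (ω : Vilenkin p) : chi 0 ω = 1 := chi_eq_one fun j => by simp

@[simp] theorem chi_zero_right (x : Vilenkin p) : chi x 0 = 1 := chi_eq_one fun j => by simp

theorem norm_chi (x ω : Vilenkin p) : ‖chi x ω‖ = 1 := by
  unfold chi
  rw [ZMod.stdAddChar_apply]
  exact Circle.norm_coe _

theorem conj_mul_chi (x ω : Vilenkin p) : (starRingEnd ℂ) (chi x ω) * chi x ω = 1 := by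
  rw [mul_comm, Complex.mul_conj, Complex.normSq_eq_norm_sq, norm_chi]
  simp

theorem chi_neg_left (x ω : Vilenkin p) : chi (-x) ω = (starRingEnd ℂ) (chi x ω) := by
  have h : chi (-x) ω * chi x ω = 1 := by rw [← chi_add_left]; simp
  have h0 : chi x ω ≠ 0 := fun h0 => by simp [h0] at h
  exact mul_right_cancel₀ h0 (h.trans (conj_mul_chi x ω).symm)

theorem chi_neg_right (x ω : Vilenkin p) : chi x (-ω) = (starRingEnd ℂ) (chi x ω) := by
  rw [chi_comm, chi_neg_left, chi_comm]

theorem chi_dil (m : ℤ) (x ω : Vilenkin p) : chi (dil m x) ω = chi x (dil m ω) := by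
  unfold chi
  congr 1
  rw [← finsum_comp_equiv (Equiv.subRight m)]
  refine finsum_congr fun j => ?_
  simp only [Equiv.subRight_apply, dil_apply, sub_add_cancel]
  congr 2
  ring

/-- `Λ` annihilates itself, so the characters `χ(n, ·)`, `n ∈ Λ`, are `Λ`-periodic. -/
theorem chi_lattice_lattice {m n : Vilenkin p} (hm : m ∈ lattice p) (hn : n ∈ lattice p) :
    chi m n = 1 := by
  refine chi_eq_one fun j => ?_
  rcases lt_or_ge 0 j with hj | hj
  · rw [hm j hj, zero_mul]
  · rw [hn (1 - j) (by omega), mul_zero]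

theorem chi_U_U {x ω : Vilenkin p} (hx : x ∈ U p) (hω : ω ∈ U p) : chi x ω = 1 := by
  refine chi_eq_one fun j => ?_
  rcases lt_or_ge 0 j with hj | hj
  · rw [hω (1 - j) (by omega), mul_zero]
  · rw [hx j hj, zero_mul]

theorem chi_single (i : ℤ) (t : ZMod p) (ω : Vilenkin p) :
    chi (single i t) ω = ZMod.stdAddChar (t * ω (1 - i)) := by
  unfold chi
  rw [finsum_eq_single _ i fun j hj => by rw [single_apply_of_ne hj, zero_mul], single_apply_self]

/-- The annihilator of `U` is no larger than `U`. -/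
theorem exists_chi_ne_one {η : Vilenkin p} (hη : η ∉ U p) : ∃ y ∈ U p, chi y η ≠ 1 := by
  rw [mem_U] at hη
  push Not at hη
  obtain ⟨i, hi, h⟩ := hη
  refine ⟨single (1 - i) 1, fun j hj => single_apply_of_ne (by omega) _, ?_⟩
  rw [chi_single, one_mul, sub_sub_cancel]
  intro h1
  exact h (ZMod.injective_stdAddChar (h1.trans (AddChar.map_zero_eq_one _).symm))

/-- If `x` and `ω` vanish below `k` and `l`, then for all pairs near `(x, ω)` only the products
`x_j ω_{1-j}` with `k ≤ j ≤ 1 - l` can be nonzero, and these are locally constant. -/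
theorem isLocallyConstant_chi :
    IsLocallyConstant fun q : Vilenkin p × Vilenkin p => chi q.1 q.2 := by
  rw [IsLocallyConstant.iff_eventually_eq]
  rintro ⟨x, ω⟩
  obtain ⟨k, hk⟩ := x.vanish
  obtain ⟨l, hl⟩ := ω.vanish
  rw [nhds_prod_eq]
  filter_upwards [prod_mem_prod (cyl_mem_nhds x (max k (1 - l)))
    (cyl_mem_nhds ω (max l (1 - k)))] with ⟨y, η⟩ ⟨hy, hη⟩
  simp only at hy hη ⊢
  unfold chi
  congr 1
  refine finsum_congr fun j => ?_
  rcases lt_or_ge j k with hj | hj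
  · rw [hy j (by omega), hk j hj, zero_mul, zero_mul]
  rcases lt_or_ge (1 - j) l with hj' | hj'
  · rw [hη (1 - j) (by omega), hl _ hj', mul_zero, mul_zero]
  · rw [hy j (by omega), hη (1 - j) (by omega)]

theorem continuous_chi : Continuous fun q : Vilenkin p × Vilenkin p => chi q.1 q.2 :=
  isLocallyConstant_chi.continuous

theorem measurable_chi_right (x : Vilenkin p) : Measurable fun ω => chi x ω :=
  (continuous_chi.comp (Continuous.prodMk_right x)).measurable

theorem measurable_chi_left (ω : Vilenkin p) : Measurable fun x => chi x ω :=
  (continuous_chi.comp (Continuous.prodMk_left ω)).measurable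

theorem norm_mul_chi (a : ℂ) (x ω : Vilenkin p) : ‖a * chi x ω‖ = ‖a‖ := by
  rw [norm_mul, norm_chi, mul_one]

theorem integrable_mul_chi {μ : Measure (Vilenkin p)} {h : Vilenkin p → ℂ} (hh : Integrable h μ)
    (x : Vilenkin p) : Integrable (fun ω => h ω * chi x ω) μ := by
  refine hh.mono (hh.1.mul (measurable_chi_right x).aestronglyMeasurable) ?_
  exact ae_of_all _ fun ω => (norm_mul_chi _ _ _).le

/-! ### Uniqueness for Fourier series -/

/-- Restricting to one value of the digit of index `i ≥ 1` is averaging over the characters of a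
cyclic subgroup of `Λ`. -/
theorem indicator_digit_eq_sum (i : ℤ) (c : ZMod p) (ω : Vilenkin p) :
    (p : ℂ)⁻¹ * ∑ t : ZMod p, ZMod.stdAddChar (-(t * c)) * chi (single (1 - i) t) ω =
      if ω i = c then 1 else 0 := by
  have hp : (p : ℂ) ≠ 0 := by exact_mod_cast NeZero.ne p
  have h := AddChar.sum_mulShift (ψ := (ZMod.stdAddChar : AddChar (ZMod p) ℂ)) (ω i - c)
    (ZMod.isPrimitive_stdAddChar p)
  have h2 : ∀ t : ZMod p, ZMod.stdAddChar (-(t * c)) * chi (single (1 - i) t) ω =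
      (ZMod.stdAddChar (t * (ω i - c)) : ℂ) := fun t => by
    rw [chi_single, sub_sub_cancel, ← AddChar.map_add_eq_mul]
    congr 1
    ring
  rw [Finset.sum_congr rfl fun t _ => h2 t, h, ZMod.card]
  simp only [sub_eq_zero]
  split_ifs
  · simp [hp]
  · simp

variable {h : Vilenkin p → ℂ}

/-- The periodic sets that are given by finitely many digits: by induction on the number of digits,
one digit at a time, as multiplication by a character of `Λ` preserves the hypothesis. -/
theorem setIntegral_cylinder_eq_zero (hi : Integrable h (haar p))
    (h0 : ∀ n ∈ lattice p, ∫ ω, h ω * chi n ω ∂haar p = 0) (c : Vilenkin p) (N : ℕ)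
    {n : Vilenkin p} (hn : n ∈ lattice p) :
    ∫ ω in {ω | ∀ j : ℤ, 0 < j → j ≤ N → ω j = c j}, h ω * chi n ω ∂haar p = 0 := by
  have hm (N : ℕ) : MeasurableSet {ω : Vilenkin p | ∀ j : ℤ, 0 < j → j ≤ N → ω j = c j} := by
    rw [← fracPart_preimage_cyl]
    exact continuous_fracPart.measurable (measurableSet_cyl _ _)
  induction N generalizing n with
  | zero =>
    have : {ω : Vilenkin p | ∀ j : ℤ, 0 < j → j ≤ (0 : ℕ) → ω j = c j} = Set.univ := by
      ext ω
      simp only [Set.mem_ofPred_eq, Set.mem_univ, iff_true]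
      intro j hj hj'
      simp only [Nat.cast_zero] at hj'
      omega
    rw [this, setIntegral_univ]
    exact h0 n hn
  | succ N ih =>
    set S := {ω : Vilenkin p | ∀ j : ℤ, 0 < j → j ≤ N → ω j = c j} with hS
    set i : ℤ := N + 1 with hi'
    have hset : ∫ ω in {ω : Vilenkin p | ∀ j : ℤ, 0 < j → j ≤ (N + 1 : ℕ) → ω j = c j},
        h ω * chi n ω ∂haar p =
        ∫ ω in S, (p : ℂ)⁻¹ * ∑ t : ZMod p, ZMod.stdAddChar (-(t * c i)) *
          (h ω * chi (n + single (1 - i) t) ω) ∂haar p := by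
      rw [← integral_indicator (hm _), ← integral_indicator (hm _)]
      refine integral_congr_ae (ae_of_all _ fun ω => ?_)
      have key : (p : ℂ)⁻¹ * ∑ t : ZMod p, ZMod.stdAddChar (-(t * c i)) *
          (h ω * chi (n + single (1 - i) t) ω) = h ω * chi n ω * if ω i = c i then 1 else 0 := by
        rw [← indicator_digit_eq_sum i (c i) ω, mul_left_comm]
        congr 1
        rw [Finset.mul_sum]
        refine Finset.sum_congr rfl fun t _ => ?_
        rw [chi_add_left]
        ring
      by_cases h1 : ω ∈ S
      · rw [Set.indicator_of_mem h1, key]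
        by_cases h2 : ω i = c i
        · rw [if_pos h2, mul_one, Set.indicator_of_mem]
          intro j hj hj'
          rcases eq_or_ne j i with rfl | hji
          · exact h2
          · exact h1 j hj (by push_cast at hj'; omega)
        · rw [if_neg h2, mul_zero, Set.indicator_of_notMem]
          intro h3
          exact h2 (h3 i (by omega) (by push_cast; omega))
      · rw [Set.indicator_of_notMem h1, Set.indicator_of_notMem]
        intro h3
        exact h1 fun j hj hj' => h3 j hj (by push_cast; omega)
    rw [hset, integral_const_mul, integral_finsetSum]
    · simp_rw [integral_const_mul]
      rw [Finset.sum_eq_zero, mul_zero]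
      intro t _
      rw [ih ((lattice p).add_mem hn (single_mem_lattice (by omega) t)), mul_zero]
    · intro t _
      exact ((integrable_mul_chi hi _).const_mul _).integrableOn

/-- An integrable function that is orthogonal to all characters `χ(n, ·)`, `n ∈ Λ`, has integral
zero over every `Λ`-periodic set. -/
theorem setIntegral_fracPart_preimage_eq_zero (hi : Integrable h (haar p))
    (h0 : ∀ n ∈ lattice p, ∫ ω, h ω * chi n ω ∂haar p = 0) {P : Set (Vilenkin p)}
    (hP : MeasurableSet P) : ∫ ω in fracPart ⁻¹' P, h ω ∂haar p = 0 := by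
  have hall : ∫ ω, h ω ∂haar p = 0 := by simpa using h0 0 (zero_mem _)
  have hm {t : Set (Vilenkin p)} (ht : MeasurableSet t) : MeasurableSet (fracPart ⁻¹' t) :=
    continuous_fracPart.measurable ht
  refine MeasurableSpace.induction_on_inter
    (C := fun P _ => ∫ ω in fracPart ⁻¹' P, h ω ∂haar p = 0)
    borel_eq_generateFrom_cylinders isPiSystem_cylinders ?_ ?_ ?_ ?_ P hP
  · simp
  · rintro _ ⟨x, N, rfl⟩
    rcases (fracPart ⁻¹' cyl x N).eq_empty_or_nonempty with he | ⟨y, hy⟩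
    · simp [he]
    · rw [← cyl_eq_of_mem hy, fracPart_preimage_cyl]
      have := setIntegral_cylinder_eq_zero hi h0 y N.toNat (zero_mem _)
      simp only [chi_zero_left, mul_one] at this
      convert this using 3
      ext ω
      exact forall_congr' fun j => ⟨fun h h1 h2 => h h1 (by omega), fun h h1 h2 => h h1 (by omega)⟩
  · intro t ht h1
    rw [Set.preimage_compl, setIntegral_compl (hm ht) hi, h1, hall, sub_zero]
  · intro f hd hfm hf
    rw [Set.preimage_iUnion, integral_iUnion (fun i => hm (hfm i))
      (fun i j hij => (hd hij).preimage _) hi.integrableOn]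
    simp [hf]

/-- Uniqueness for Fourier series: if the translates of `E` by `Λ` are almost disjoint, then an
integrable function supported on `E` is determined by its integrals against the characters
`χ(n, ·)`, `n ∈ Λ`. -/
theorem ae_eq_zero_of_integral_mul_chi_eq_zero (hi : Integrable h (haar p)) {E : Set (Vilenkin p)}
    (hE : MeasurableSet E)
    (hdisj : ∀ n : lattice p, n ≠ 0 → haar p (E ∩ (fun ω => ω + (n : Vilenkin p)) '' E) = 0)
    (hsupp : ∀ᵐ ω ∂haar p, ω ∉ E → h ω = 0)
    (h0 : ∀ n ∈ lattice p, ∫ ω, h ω * chi n ω ∂haar p = 0) : h =ᵐ[haar p] 0 := by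
  -- up to a null set, `B = s ∩ E` is the intersection of `E` with its `Λ`-periodic hull `P`
  refine Integrable.ae_eq_zero_of_forall_setIntegral_eq_zero hi fun s hs _ => ?_
  set B := s ∩ E with hB
  set P : Set (Vilenkin p) := ⋃ n : lattice p, (fun ω => ω + (n : Vilenkin p)) '' B with hP
  have hBm : MeasurableSet B := hs.inter hE
  have hPm : MeasurableSet P := MeasurableSet.iUnion fun n =>
    (MeasurableEquiv.addRight (n : Vilenkin p)).measurableSet_image.2 hBm
  have hPinv : fracPart ⁻¹' P = P := by
    ext ω
    simp only [hP, Set.mem_preimage, Set.mem_iUnion, Set.mem_image, ← sub_intPart]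
    constructor
    · rintro ⟨n, η, hη, h⟩
      refine ⟨n + intPart ω, η, hη, ?_⟩
      rw [AddSubgroup.coe_add, ← add_assoc, h, sub_add_cancel]
    · rintro ⟨n, η, hη, h⟩
      refine ⟨n - intPart ω, η, hη, ?_⟩
      rw [AddSubgroup.coe_sub, ← add_sub_assoc, h]
  have h1 := setIntegral_fracPart_preimage_eq_zero hi h0 hPm
  rw [hPinv] at h1
  rw [← h1, ← integral_indicator hs, ← integral_indicator hPm]
  refine integral_congr_ae ?_
  have hnull : ∀ᵐ ω ∂haar p, ∀ n : lattice p, n ≠ 0 →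
      ω ∉ E ∩ (fun ω => ω + (n : Vilenkin p)) '' E := by
    rw [ae_all_iff]
    intro n
    by_cases hn : n = 0
    · simp [hn]
    · filter_upwards [measure_eq_zero_iff_ae_notMem.1 (hdisj n hn)] with ω hω _ using hω
  filter_upwards [hsupp, hnull] with ω h2 h3
  by_cases hωE : ω ∈ E
  · have : ω ∈ s ↔ ω ∈ P := by
      constructor
      · intro hω
        exact Set.mem_iUnion.2 ⟨0, ω, ⟨hω, hωE⟩, by simp⟩
      · intro hω
        obtain ⟨n, η, hη, h⟩ := Set.mem_iUnion.1 hω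
        by_cases hn : n = 0
        · subst hn
          simp only [AddSubgroup.coe_zero, add_zero] at h
          exact h ▸ hη.1
        · exact absurd ⟨hωE, η, hη.2, h⟩ (h3 n hn)
    by_cases hωs : ω ∈ s
    · rw [Set.indicator_of_mem hωs, Set.indicator_of_mem (this.1 hωs)]
    · rw [Set.indicator_of_notMem hωs, Set.indicator_of_notMem fun h => hωs (this.2 h)]
  · simp [Set.indicator, h2 hωE]

end Vilenkin

namespace Vilenkin

variable {p : ℕ}

/-! ### The Gabor basis -/

/-- The coset `U + n`. -/
def cell (n : lattice p) : Set (Vilenkin p) := {x | x - (n : Vilenkin p) ∈ U p}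

theorem mem_cell_intPart (x : Vilenkin p) : x ∈ cell (intPart x) := sub_intPart_mem_U x

theorem measurableSet_cell (n : lattice p) : MeasurableSet (cell n) :=
  (measurable_sub_const (n : Vilenkin p)) measurableSet_U

theorem cell_inter_translate_eq_empty (n m : lattice p) (hm : m ≠ 0) :
    cell n ∩ (fun x => x + (m : Vilenkin p)) '' cell n = ∅ := by
  rw [Set.eq_empty_iff_forall_notMem]
  rintro _ ⟨hx, y, hy, rfl⟩
  refine hm ?_
  have h1 : y - ((n - m : lattice p) : Vilenkin p) ∈ U p := by
    have : y - ((n - m : lattice p) : Vilenkin p) = y + (m : Vilenkin p) - (n : Vilenkin p) := by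
      rw [AddSubgroup.coe_sub]
      abel
    rw [this]
    exact hx
  have h2 := eq_of_sub_mem_U hy h1
  exact sub_eq_self.1 h2.symm

theorem lattice_mem_cell_iff {m n : lattice p} : (m : Vilenkin p) ∈ cell n ↔ m = n := by
  constructor
  · intro h
    exact eq_of_sub_mem_U (x := (m : Vilenkin p)) (by rw [sub_self]; exact fun j _ => rfl) h
  · rintro rfl
    intro j _
    simp

variable [NeZero p]

theorem haar_cell (n : lattice p) : haar p (cell n) = 1 := by
  have : cell n = (fun x => x + (-(n : Vilenkin p))) ⁻¹' U p := by
    ext x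
    simp [cell, sub_eq_add_neg]
  rw [this, measure_preimage_add_right, haar_U]

theorem integral_U_chi (η : Vilenkin p) [Decidable (η ∈ U p)] :
    ∫ x in U p, chi x η ∂haar p = if η ∈ U p then 1 else 0 := by
  split_ifs with h
  · rw [setIntegral_congr_fun measurableSet_U fun x hx => chi_U_U hx h]
    simp [haar_U, Measure.real]
  · obtain ⟨y, hy, hne⟩ := exists_chi_ne_one h
    have h1 : ∫ x in U p, chi x η ∂haar p = chi y η * ∫ x in U p, chi x η ∂haar p := by
      rw [← integral_const_mul, ← integral_indicator measurableSet_U,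
        ← integral_indicator measurableSet_U,
        ← integral_add_left_eq_self (fun x => (U p).indicator (fun x => chi x η) x) y]
      refine integral_congr_ae (ae_of_all _ fun x => ?_)
      have hiff : y + x ∈ U p ↔ x ∈ U p := by
        refine forall_congr' fun j => imp_congr_right fun hj => ?_
        rw [add_apply, hy j hj, zero_add]
      by_cases hx : x ∈ U p
      · simp only [Set.indicator_of_mem hx, Set.indicator_of_mem (hiff.2 hx), chi_add_left]
      · simp only [Set.indicator_of_notMem hx, Set.indicator_of_notMem fun h => hx (hiff.1 h)]
    have h2 : (1 - chi y η) * ∫ x in U p, chi x η ∂haar p = 0 := by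
      rw [sub_mul, one_mul, ← h1, sub_self]
    exact (mul_eq_zero.1 h2).resolve_left (sub_ne_zero.2 (Ne.symm hne))

/-- The Gabor atom `χ(·, k) 1_{U + n}`. -/
noncomputable def atom (n k : lattice p) : Vilenkin p → ℂ :=
  (cell n).indicator fun x => chi x (k : Vilenkin p)

theorem measurable_atom (n k : lattice p) : Measurable (atom n k) :=
  (measurable_chi_left _).indicator (measurableSet_cell n)

theorem memLp_atom (n k : lattice p) (q : ENNReal) : MemLp (atom n k) q (haar p) := by
  refine (memLp_indicator_const q (measurableSet_cell n) (1 : ℂ)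
    (Or.inr (by simp [haar_cell]))).of_le (measurable_atom n k).aestronglyMeasurable
    (ae_of_all _ fun x => ?_)
  unfold atom
  by_cases hx : x ∈ cell n
  · rw [Set.indicator_of_mem hx, Set.indicator_of_mem hx, norm_chi, norm_one]
  · rw [Set.indicator_of_notMem hx, norm_zero]
    exact norm_nonneg _

theorem integrable_atom (n k : lattice p) : Integrable (atom n k) (haar p) :=
  memLp_one_iff_integrable.1 (memLp_atom n k 1)

theorem conj_atom (n k : lattice p) (x : Vilenkin p) :
    (starRingEnd ℂ) (atom n k x) = atom n (-k) x := by
  unfold atom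
  by_cases hx : x ∈ cell n
  · rw [Set.indicator_of_mem hx, Set.indicator_of_mem hx, AddSubgroup.coe_neg, chi_neg_right]
  · rw [Set.indicator_of_notMem hx, Set.indicator_of_notMem hx, map_zero]

/-- A shifted form of the orthogonality of the characters on `U`. -/
theorem integral_atom_mul_chi (n k : lattice p) (η : Vilenkin p) [Decidable (η ∈ cell k)] :
    ∫ x, atom n k x * chi x (-η) ∂haar p =
      if η ∈ cell k then chi (n : Vilenkin p) (-η) else 0 := by
  classical
  rw [← integral_add_right_eq_self _ (n : Vilenkin p)]
  have h1 : ∀ x, atom n k (x + (n : Vilenkin p)) * chi (x + (n : Vilenkin p)) (-η) =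
      chi (n : Vilenkin p) (-η) * (U p).indicator (fun x => chi x (k - η)) x := fun x => by
    unfold atom
    by_cases hx : x ∈ U p
    · have hx' : x + (n : Vilenkin p) ∈ cell n := by simpa [cell] using hx
      rw [Set.indicator_of_mem hx, Set.indicator_of_mem hx', chi_add_left, chi_add_left,
        chi_lattice_lattice n.2 k.2, sub_eq_add_neg, chi_add_right]
      ring
    · have hx' : x + (n : Vilenkin p) ∉ cell n := by simpa [cell] using hx
      rw [Set.indicator_of_notMem hx, Set.indicator_of_notMem hx', zero_mul, mul_zero]
  simp_rw [h1]
  rw [integral_const_mul, integral_indicator measurableSet_U, integral_U_chi]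
  have : (k : Vilenkin p) - η ∈ U p ↔ η ∈ cell k := by
    rw [← neg_sub]
    exact ⟨fun h => by
      have := neg_mem_U h
      rw [neg_neg] at this
      exact this, fun h => neg_mem_U h⟩
  simp only [this, mul_ite, mul_one, mul_zero]

/-- The Fourier transform permutes the Gabor atoms. -/
theorem fourierIntegral_atom (n k : lattice p) : fourierIntegral (atom n k) = atom k (-n) := by
  classical
  funext ω
  unfold fourierIntegral
  simp only [← chi_neg_right]
  rw [integral_atom_mul_chi]
  unfold atom
  rw [Set.indicator_apply, chi_neg_right, ← chi_neg_left, chi_comm, AddSubgroup.coe_neg]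

theorem inner_toLp {f g : Vilenkin p → ℂ} (hf : MemLp f 2 (haar p)) (hg : MemLp g 2 (haar p)) :
    inner ℂ (hf.toLp f) (hg.toLp g) = ∫ x, (starRingEnd ℂ) (f x) * g x ∂haar p := by
  rw [L2.inner_def]
  refine integral_congr_ae ?_
  filter_upwards [hf.coeFn_toLp, hg.coeFn_toLp] with x h1 h2
  rw [h1, h2, RCLike.inner_apply, mul_comm]

theorem inner_toLp_left {f : Vilenkin p → ℂ} (hf : MemLp f 2 (haar p)) (g : L2 p) :
    inner ℂ (hf.toLp f) g = ∫ x, (starRingEnd ℂ) (f x) * g x ∂haar p := by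
  rw [← inner_toLp hf (Lp.memLp g), Lp.toLp_coeFn]

/-- The class in `L²(G)` of a Gabor atom. -/
noncomputable def atomL2 (q : lattice p × lattice p) : L2 p :=
  (memLp_atom q.1 q.2 2).toLp (atom q.1 q.2)

theorem orthonormal_atomL2 : Orthonormal ℂ (atomL2 : lattice p × lattice p → L2 p) := by
  classical
  rw [orthonormal_iff_ite]
  rintro ⟨n, k⟩ ⟨n', k'⟩
  rw [atomL2, atomL2, inner_toLp]
  simp only [conj_atom]
  by_cases hn : n = n'
  · subst hn
    have h : ∀ x, atom n (-k) x * atom n k' x = atom n k' x * chi x (-(k : Vilenkin p)) :=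
      fun x => by
      unfold atom
      by_cases hx : x ∈ cell n
      · simp only [Set.indicator_of_mem hx]
        rw [mul_comm, AddSubgroup.coe_neg]
      · simp only [Set.indicator_of_notMem hx, zero_mul]
    simp_rw [h]
    rw [integral_atom_mul_chi]
    simp only [lattice_mem_cell_iff, Prod.mk.injEq, true_and]
    rw [← AddSubgroup.coe_neg, chi_lattice_lattice n.2 (-k).2]
  · rw [if_neg (by simp [hn]), integral_eq_zero_of_ae]
    refine ae_of_all _ fun x => ?_
    unfold atom
    by_cases hx : x ∈ cell n
    · have : x ∉ cell n' := fun hx' => hn (eq_of_sub_mem_U hx hx')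
      simp only [Set.indicator_of_notMem this, mul_zero, Pi.zero_apply]
    · simp only [Set.indicator_of_notMem hx, zero_mul, Pi.zero_apply]

/-- A function that is integrable on each coset of `U` and orthogonal to all Gabor atoms
vanishes. -/
theorem ae_eq_zero_of_integral_mul_atom {f : Vilenkin p → ℂ}
    (hi : ∀ n : lattice p, IntegrableOn f (cell n) (haar p))
    (h0 : ∀ n k : lattice p, ∫ x, f x * atom n k x ∂haar p = 0) : f =ᵐ[haar p] 0 := by
  have key (n : lattice p) : (cell n).indicator f =ᵐ[haar p] 0 := by
    refine ae_eq_zero_of_integral_mul_chi_eq_zero (E := cell n)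
      ((integrable_indicator_iff (measurableSet_cell n)).2 (hi n))
      (measurableSet_cell n) (fun m hm => by rw [cell_inter_translate_eq_empty n m hm]; simp)
      (ae_of_all _ fun x hx => Set.indicator_of_notMem hx _) fun k hk => ?_
    rw [← h0 n ⟨k, hk⟩]
    refine integral_congr_ae (ae_of_all _ fun x => ?_)
    unfold atom
    by_cases hx : x ∈ cell n
    · simp only [Set.indicator_of_mem hx, chi_comm k]
    · simp only [Set.indicator_of_notMem hx, zero_mul, mul_zero]
  filter_upwards [ae_all_iff.2 key] with x hx
  rw [← hx (intPart x), Set.indicator_of_mem (mem_cell_intPart x)]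

theorem integrableOn_cell {f : Vilenkin p → ℂ} (hf : MemLp f 2 (haar p)) (n : lattice p) :
    IntegrableOn f (cell n) (haar p) := by
  have : IsFiniteMeasure ((haar p).restrict (cell n)) :=
    ⟨by simp [haar_cell]⟩
  exact (hf.restrict (cell n)).integrable (by norm_num)

theorem span_atomL2_orthogonal :
    (Submodule.span ℂ (Set.range (atomL2 : lattice p × lattice p → L2 p)))ᗮ = ⊥ := by
  rw [Submodule.eq_bot_iff]
  intro f hf
  rw [Submodule.mem_orthogonal] at hf
  refine (Lp.eq_zero_iff_ae_eq_zero).2 (ae_eq_zero_of_integral_mul_atom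
    (integrableOn_cell (Lp.memLp f)) fun n k => ?_)
  have := hf (atomL2 (n, -k)) (Submodule.subset_span ⟨_, rfl⟩)
  rw [atomL2, inner_toLp_left] at this
  simpa only [conj_atom, neg_neg, mul_comm] using this

/-- The Gabor basis of `L²(G)`. -/
noncomputable def gabor (p : ℕ) [NeZero p] : HilbertBasis (lattice p × lattice p) ℂ (L2 p) :=
  HilbertBasis.mkOfOrthogonalEqBot orthonormal_atomL2 span_atomL2_orthogonal

theorem coe_gabor : ⇑(gabor p) = atomL2 :=
  HilbertBasis.coe_mkOfOrthogonalEqBot _ _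

/-- The permutation of the index set of the Gabor basis that is induced by the Fourier transform. -/
def gaborPerm (p : ℕ) : lattice p × lattice p ≃ lattice p × lattice p where
  toFun q := (q.2, -q.1)
  invFun q := (-q.2, q.1)
  left_inv q := by simp
  right_inv q := by simp

/-- The Gabor basis, reindexed along `gaborPerm`. -/
noncomputable def gaborDual (p : ℕ) [NeZero p] : HilbertBasis (lattice p × lattice p) ℂ (L2 p) :=
  HilbertBasis.mkOfOrthogonalEqBot (v := fun q => atomL2 (gaborPerm p q))
    (orthonormal_atomL2.comp _ (gaborPerm p).injective) (by
      have : Set.range (fun q => atomL2 (gaborPerm p q)) = Set.range atomL2 :=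
        (gaborPerm p).surjective.range_comp atomL2
      rw [this]
      exact span_atomL2_orthogonal)

theorem gaborDual_apply (q : lattice p × lattice p) : gaborDual p q = atomL2 (q.2, -q.1) :=
  congrFun (HilbertBasis.coe_mkOfOrthogonalEqBot _ _) q

/-! ### The Fourier transform on `L²(G)` -/

/-- The Fourier transform of `L²(G)` as a unitary operator, defined by its action on the Gabor
basis. -/
noncomputable def fourierL2 (p : ℕ) [NeZero p] : L2 p ≃ₗᵢ[ℂ] L2 p :=
  (gabor p).repr.trans (gaborDual p).repr.symm

theorem fourierL2_atomL2 (n k : lattice p) : fourierL2 p (atomL2 (n, k)) = atomL2 (k, -n) := by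
  classical
  rw [← coe_gabor, fourierL2, LinearIsometryEquiv.trans_apply, HilbertBasis.repr_self,
    HilbertBasis.repr_symm_single, gaborDual_apply, coe_gabor]

theorem aestronglyMeasurable_fourierIntegral {f : Vilenkin p → ℂ} (hf : Integrable f (haar p)) :
    AEStronglyMeasurable (fourierIntegral f) (haar p) := by
  have h : AEStronglyMeasurable (fun q : Vilenkin p × Vilenkin p =>
      f q.2 * (starRingEnd ℂ) (chi q.2 q.1)) ((haar p).prod (haar p)) := by
    refine hf.1.comp_snd.mul ?_
    exact (Complex.continuous_conj.comp (continuous_chi.comp continuous_swap)).aestronglyMeasurable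
  exact h.integral_prod_right'

theorem norm_fourierIntegral_le (f : Vilenkin p → ℂ) (ω : Vilenkin p) :
    ‖fourierIntegral f ω‖ ≤ ∫ x, ‖f x‖ ∂haar p := by
  refine (norm_integral_le_integral_norm _).trans (le_of_eq ?_)
  simp [norm_chi]

/-- The multiplication formula. -/
theorem integral_fourierIntegral_mul {f g : Vilenkin p → ℂ} (hf : Integrable f (haar p))
    (hg : Integrable g (haar p)) :
    ∫ ω, fourierIntegral f ω * g ω ∂haar p = ∫ x, f x * fourierIntegral g x ∂haar p := by
  unfold fourierIntegral
  simp_rw [← integral_mul_const, ← integral_const_mul]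
  rw [integral_integral_swap]
  · refine integral_congr_ae (ae_of_all _ fun x => integral_congr_ae (ae_of_all _ fun ω => ?_))
    simp only [chi_comm ω x]
    ring
  · refine ((hg.mul_prod hf)).mono ?_ (ae_of_all _ fun q => ?_)
    · refine ((hf.1.comp_snd).mul ?_).mul hg.1.comp_fst
      exact (Complex.continuous_conj.comp
        (continuous_chi.comp continuous_swap)).aestronglyMeasurable
    · simp [Function.uncurry, norm_chi, mul_comm]

/-- On `L¹(G) ∩ L²(G)` the unitary operator is given by the Fourier integral. Both sides have the
same inner products with the atoms. -/
theorem fourierIntegral_ae_eq {f : Vilenkin p → ℂ} (hf : Integrable f (haar p))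
    (hf2 : MemLp f 2 (haar p)) : fourierIntegral f =ᵐ[haar p] fourierL2 p (hf2.toLp f) := by
  set g := fourierL2 p (hf2.toLp f) with hg
  have hi1 (n : lattice p) : IntegrableOn (fourierIntegral f) (cell n) (haar p) := by
    have : IsFiniteMeasure ((haar p).restrict (cell n)) := ⟨by simp [haar_cell]⟩
    exact Integrable.of_bound (aestronglyMeasurable_fourierIntegral hf).restrict
      (∫ x, ‖f x‖ ∂haar p) (ae_of_all _ (norm_fourierIntegral_le f))
  have hi2 (n : lattice p) := integrableOn_cell (Lp.memLp g) n
  have hmul {F : Vilenkin p → ℂ} (n k : lattice p) (hF : IntegrableOn F (cell n) (haar p)) :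
      Integrable (fun x => F x * atom n k x) (haar p) := by
    have := integrable_mul_chi ((integrable_indicator_iff (measurableSet_cell n)).2 hF) k
    refine this.congr (ae_of_all _ fun x => ?_)
    unfold atom
    by_cases hx : x ∈ cell n
    · simp only [Set.indicator_of_mem hx, chi_comm (k : Vilenkin p)]
    · simp only [Set.indicator_of_notMem hx, zero_mul, mul_zero]
  have h := ae_eq_zero_of_integral_mul_atom (f := fun x => fourierIntegral f x - g x)
    (fun n => (hi1 n).sub (hi2 n)) fun n k => ?_
  · filter_upwards [h] with x hx using sub_eq_zero.1 hx
  simp_rw [sub_mul]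
  rw [integral_sub (hmul n k (hi1 n)) (hmul n k (hi2 n)),
    integral_fourierIntegral_mul hf (integrable_atom n k), fourierIntegral_atom, sub_eq_zero]
  -- both sides are the inner product of `f` with an atom, as `fourierL2` is unitary
  have h1 : inner ℂ (atomL2 (k, n)) (hf2.toLp f) = inner ℂ (atomL2 (n, -k)) g := by
    rw [← fourierL2_atomL2, hg, LinearIsometryEquiv.inner_map_map]
  rw [atomL2, atomL2, inner_toLp, inner_toLp_left] at h1
  simp only [conj_atom, neg_neg] at h1
  simpa only [mul_comm] using h1

theorem toLp_eq_toLp_of_ae {f g : Vilenkin p → ℂ} (h : f =ᵐ[haar p] g)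
    (hf : MemLp f 2 (haar p)) (hg : MemLp g 2 (haar p)) : hf.toLp f = hg.toLp g :=
  (MemLp.toLp_eq_toLp_iff hf hg).2 h

/-- The extension by continuity of the Fourier integral is the unitary operator `fourierL2`. -/
theorem isFourierTransform_iff {f g : Vilenkin p → ℂ} : IsFourierTransform f g ↔
    ∃ (hf : MemLp f 2 (haar p)) (hg : MemLp g 2 (haar p)),
      fourierL2 p (hf.toLp f) = hg.toLp g := by
  have key {F : Vilenkin p → ℂ} (hF : Integrable F (haar p)) (hF2 : MemLp F 2 (haar p))
      (hg : MemLp g 2 (haar p)) : eLpNorm (fourierIntegral F - g) 2 (haar p) =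
        edist (fourierL2 p (hF2.toLp F)) (hg.toLp g) := by
    rw [Lp.edist_def]
    refine eLpNorm_congr_ae ?_
    filter_upwards [fourierIntegral_ae_eq hF hF2, hg.coeFn_toLp] with x h1 h2
    simp only [Pi.sub_apply, h1, h2]
  constructor
  · rintro ⟨hf, hg, F, hF, h1, h2⟩
    refine ⟨hf, hg, tendsto_nhds_unique (f := fun k => fourierL2 p ((hF k).2.toLp (F k)))
      (l := atTop) ?_ ?_⟩
    · refine ((fourierL2 p).continuous.tendsto _).comp ?_
      rw [tendsto_iff_edist_tendsto_0]
      simpa only [Lp.edist_toLp_toLp] using h1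
    · rw [tendsto_iff_edist_tendsto_0]
      simpa only [key (hF _).1 (hF _).2 hg] using h2
  · rintro ⟨hf, hg, h⟩
    refine ⟨hf, hg, ?_⟩
    -- simple functions in `L²(G)` are integrable
    have hex (k : ℕ) : ∃ F : Vilenkin p → ℂ, eLpNorm (f - F) 2 (haar p) < (k + 1 : ENNReal)⁻¹ ∧
        Integrable F (haar p) ∧ MemLp F 2 (haar p) := by
      obtain ⟨F, h1, h2⟩ := hf.exists_simpleFunc_eLpNorm_sub_lt (by norm_num)
        (ε := (k + 1 : ENNReal)⁻¹) (by simp)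
      exact ⟨F, h1, (SimpleFunc.memLp_iff_integrable (by norm_num) (by norm_num)).1 h2, h2⟩
    choose F h1 h2 using hex
    have hlim : Tendsto (fun k => eLpNorm (F k - f) 2 (haar p)) atTop (𝓝 0) := by
      have h0 : Tendsto (fun k : ℕ => ((k + 1 : ℕ) : ENNReal)⁻¹) atTop (𝓝 0) :=
        ENNReal.tendsto_inv_nat_nhds_zero.comp (tendsto_add_atTop_nat 1)
      refine tendsto_of_tendsto_of_tendsto_of_le_of_le tendsto_const_nhds h0
        (fun _ => zero_le) fun k => ?_
      rw [eLpNorm_sub_comm]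
      exact_mod_cast (h1 k).le
    refine ⟨F, h2, hlim, ?_⟩
    simp_rw [key (h2 _).1 (h2 _).2 hg, ← h, LinearIsometryEquiv.edist_map, Lp.edist_toLp_toLp]
    exact hlim

theorem isFourierTransform_ae_unique {f f' g : Vilenkin p → ℂ} (h : IsFourierTransform f g)
    (h' : IsFourierTransform f' g) : f =ᵐ[haar p] f' := by
  obtain ⟨hf, hg, h1⟩ := isFourierTransform_iff.1 h
  obtain ⟨hf', hg', h2⟩ := isFourierTransform_iff.1 h'
  exact (MemLp.toLp_eq_toLp_iff hf hf').1 ((fourierL2 p).injective (h1.trans h2.symm))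

theorem exists_isFourierTransform {g : Vilenkin p → ℂ} (hg : MemLp g 2 (haar p)) :
    ∃ f, IsFourierTransform f g := by
  refine ⟨(fourierL2 p).symm (hg.toLp g), isFourierTransform_iff.2 ⟨Lp.memLp _, hg, ?_⟩⟩
  rw [Lp.toLp_coeFn, LinearIsometryEquiv.apply_symm_apply]

/-- Where the inverse Fourier integral of an indicator is in `L²(G)`, it inverts the Fourier
transform. -/
theorem isFourierTransform_invFourierIntegral {Ω : Set (Vilenkin p)} (hΩ : MeasurableSet Ω)
    (hfin : haar p Ω < ⊤)
    (hL2 : MemLp (invFourierIntegral (Ω.indicator fun _ => 1)) 2 (haar p)) :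
    IsFourierTransform (invFourierIntegral (Ω.indicator fun _ => 1)) (Ω.indicator fun _ => 1) := by
  have hg : MemLp (Ω.indicator fun _ => (1 : ℂ)) 2 (haar p) :=
    memLp_indicator_const 2 hΩ 1 (Or.inr hfin.ne)
  have hg1 : Integrable (Ω.indicator fun _ => (1 : ℂ)) (haar p) :=
    memLp_one_iff_integrable.1 (memLp_indicator_const 1 hΩ 1 (Or.inr hfin.ne))
  have hconj : ∀ x, invFourierIntegral (Ω.indicator fun _ => 1) x =
      (starRingEnd ℂ) (fourierIntegral (Ω.indicator fun _ => 1) x) := fun x => by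
    unfold invFourierIntegral fourierIntegral
    rw [← integral_conj]
    refine integral_congr_ae (ae_of_all _ fun ω => ?_)
    simp only [map_mul, Complex.conj_conj, chi_comm x]
    by_cases hω : ω ∈ Ω
    · simp [hω]
    · simp [hω]
  refine isFourierTransform_iff.2 ⟨hL2, hg, ?_⟩
  rw [← LinearIsometryEquiv.eq_symm_apply]
  refine (gabor p).repr.injective ?_
  ext ⟨n, k⟩
  rw [HilbertBasis.repr_apply_apply, HilbertBasis.repr_apply_apply, coe_gabor,
    ← (fourierL2 p).inner_map_map _ ((fourierL2 p).symm _),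
    LinearIsometryEquiv.apply_symm_apply, fourierL2_atomL2, atomL2, atomL2, inner_toLp, inner_toLp]
  simp only [hconj, ← map_mul, integral_conj]
  have := integral_fourierIntegral_mul (integrable_atom n k) hg1
  rw [← this, fourierIntegral_atom, ← integral_conj]
  refine integral_congr_ae (ae_of_all _ fun ω => ?_)
  by_cases hω : ω ∈ Ω
  · simp [hω]
  · simp [hω]

end Vilenkin

namespace Vilenkin

variable {p : ℕ}

/-! ### Dilations and translations under the Fourier transform -/

theorem dilTrans_zero (f : Vilenkin p → ℂ) (n : lattice p) :
    dilTrans f 0 n = fun x => f (x - (n : Vilenkin p)) := by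
  funext x
  simp [dilTrans]

variable [NeZero p]

/-- The counterpart of `dilTrans` on the side of the dual group: if `g` is the Fourier transform of
`f`, then `modDil g j n` is the Fourier transform of `f_{j,n}`. -/
noncomputable def modDil (g : Vilenkin p → ℂ) (j : ℤ) (n : lattice p) : Vilenkin p → ℂ :=
  fun ω => (((p : ℝ) ^ (-(j : ℝ) / 2) : ℝ) : ℂ) *
    ((starRingEnd ℂ) (chi (n : Vilenkin p) (dil (-j) ω)) * g (dil (-j) ω))

theorem natCast_pos_real : (0 : ℝ) < p := by exact_mod_cast Nat.pos_of_ne_zero (NeZero.ne p)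

theorem quasiMeasurePreserving_dil_sub (j : ℤ) (n : lattice p) :
    Measure.QuasiMeasurePreserving (fun x => dil j x - (n : Vilenkin p)) (haar p) (haar p) :=
  (measurePreserving_sub_right (haar p) (n : Vilenkin p)).quasiMeasurePreserving.comp
    (quasiMeasurePreserving_dil j)

theorem ofReal_rpow_mul_cancel (a : ℝ) (c : ENNReal) :
    ENNReal.ofReal ((p : ℝ) ^ a) * (ENNReal.ofReal ((p : ℝ) ^ (-a)) * c) = c := by
  have hp := natCast_pos_real (p := p)
  rw [← mul_assoc, ← ENNReal.ofReal_mul (by positivity), ← Real.rpow_add hp, add_neg_cancel,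
    Real.rpow_zero, ENNReal.ofReal_one, one_mul]

theorem eLpNorm_dilTrans {f : Vilenkin p → ℂ} (hf : AEStronglyMeasurable f (haar p)) (j : ℤ)
    (n : lattice p) : eLpNorm (dilTrans f j n) 2 (haar p) = eLpNorm f 2 (haar p) := by
  have hp := natCast_pos_real (p := p)
  have h : dilTrans f j n =
      (((p : ℝ) ^ ((j : ℝ) / 2) : ℝ) : ℂ) • fun x => (fun y => f (y - (n : Vilenkin p))) (dil j x) :=
    rfl
  rw [h, eLpNorm_const_smul, eLpNorm_comp_dil j fun y => f (y - (n : Vilenkin p))]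
  have h2 : eLpNorm (fun y => f (y - (n : Vilenkin p))) 2 (haar p) = eLpNorm f 2 (haar p) :=
    eLpNorm_comp_measurePreserving hf (measurePreserving_sub_right (haar p) (n : Vilenkin p))
  rw [h2, ← ofReal_norm, Complex.norm_real, Real.norm_of_nonneg (by positivity), neg_div,
    ofReal_rpow_mul_cancel]

theorem memLp_dilTrans {f : Vilenkin p → ℂ} (hf : MemLp f 2 (haar p)) (j : ℤ) (n : lattice p) :
    MemLp (dilTrans f j n) 2 (haar p) := by
  refine ⟨(hf.1.comp_quasiMeasurePreserving (quasiMeasurePreserving_dil_sub j n)).const_mul _, ?_⟩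
  rw [eLpNorm_dilTrans hf.1]
  exact hf.2

theorem integrable_dilTrans {f : Vilenkin p → ℂ} (hf : Integrable f (haar p)) (j : ℤ)
    (n : lattice p) : Integrable (dilTrans f j n) (haar p) := by
  refine Integrable.const_mul ?_ _
  have h1 : Integrable (fun y => f (y - (n : Vilenkin p))) (haar p) := hf.comp_sub_right _
  have h2 := (measurableEmbedding_dil (p := p) j).integrable_map_iff (μ := haar p)
    (g := fun y => f (y - (n : Vilenkin p)))
  refine h2.1 ?_
  rw [map_dil]
  exact h1.smul_measure (ENNReal.zpow_ne_top natCast_ne_zero (ENNReal.natCast_ne_top p) _)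

theorem eLpNorm_modDil (g : Vilenkin p → ℂ) (j : ℤ) (n : lattice p) :
    eLpNorm (modDil g j n) 2 (haar p) = eLpNorm g 2 (haar p) := by
  have hp := natCast_pos_real (p := p)
  have h : eLpNorm (modDil g j n) 2 (haar p) =
      eLpNorm ((((p : ℝ) ^ (-(j : ℝ) / 2) : ℝ) : ℂ) • fun x => g (dil (-j) x)) 2 (haar p) := by
    refine eLpNorm_congr_norm_ae (ae_of_all _ fun ω => ?_)
    simp [modDil, norm_chi]
  rw [h, eLpNorm_const_smul, eLpNorm_comp_dil, ← ofReal_norm, Complex.norm_real,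
    Real.norm_of_nonneg (by positivity)]
  convert ofReal_rpow_mul_cancel (p := p) (-(j : ℝ) / 2) _ using 4
  push_cast
  ring_nf

theorem memLp_modDil {g : Vilenkin p → ℂ} (hg : MemLp g 2 (haar p)) (j : ℤ) (n : lattice p) :
    MemLp (modDil g j n) 2 (haar p) := by
  refine ⟨(AEStronglyMeasurable.mul ?_
    (hg.1.comp_quasiMeasurePreserving (quasiMeasurePreserving_dil (-j)))).const_mul _, ?_⟩
  · exact (Complex.continuous_conj.measurable.comp
      ((measurable_chi_right _).comp (measurable_dil _))).aestronglyMeasurable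
  · rw [eLpNorm_modDil]
    exact hg.2

theorem fourierIntegral_dilTrans (f : Vilenkin p → ℂ) (j : ℤ) (n : lattice p) :
    fourierIntegral (dilTrans f j n) = modDil (fourierIntegral f) j n := by
  have hp := natCast_pos_real (p := p)
  funext ω
  set η := dil (-j) ω with hη
  have h1 : ∀ x, dilTrans f j n x * (starRingEnd ℂ) (chi x ω) =
      (fun y => (((p : ℝ) ^ ((j : ℝ) / 2) : ℝ) : ℂ) *
        (f (y - (n : Vilenkin p)) * (starRingEnd ℂ) (chi y η))) (dil j x) := fun x => by
    simp only [dilTrans, hη, ← chi_dil, dil_neg_dil]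
    ring
  have h2 : ∀ y, f (y - (n : Vilenkin p)) * (starRingEnd ℂ) (chi y η) =
      (fun z => (starRingEnd ℂ) (chi (n : Vilenkin p) η) * (f z * (starRingEnd ℂ) (chi z η)))
        (y - (n : Vilenkin p)) := fun y => by
    have : chi y η = chi (y - (n : Vilenkin p)) η * chi (n : Vilenkin p) η := by
      rw [← chi_add_left, sub_add_cancel]
    simp only [this, map_mul]
    ring
  simp only [fourierIntegral, modDil, ← hη]
  rw [integral_congr_ae (ae_of_all _ h1), integral_comp_dil j fun y =>
    (((p : ℝ) ^ ((j : ℝ) / 2) : ℝ) : ℂ) *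
      (f (y - (n : Vilenkin p)) * (starRingEnd ℂ) (chi y η)), integral_const_mul]
  simp_rw [h2]
  rw [integral_sub_right_eq_self
    (fun z => (starRingEnd ℂ) (chi (n : Vilenkin p) η) * (f z * (starRingEnd ℂ) (chi z η))),
    integral_const_mul, ← mul_assoc, ← Complex.ofReal_mul, ← Real.rpow_intCast,
    ← Real.rpow_add hp]
  congr 3
  push_cast
  ring_nf

/-- The operators `f ↦ f_{j,n}` and `g ↦ modDil g j n` are isometric, so the statement passes from
`L¹ ∩ L²` to the limit. -/
theorem IsFourierTransform.dilTrans {f g : Vilenkin p → ℂ} (h : IsFourierTransform f g) (j : ℤ)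
    (n : lattice p) : IsFourierTransform (Vilenkin.dilTrans f j n) (modDil g j n) := by
  obtain ⟨hf, hg, F, hF, h1, h2⟩ := h
  refine ⟨memLp_dilTrans hf j n, memLp_modDil hg j n, fun k => Vilenkin.dilTrans (F k) j n,
    fun k => ⟨integrable_dilTrans (hF k).1 j n, memLp_dilTrans (hF k).2 j n⟩, ?_, ?_⟩
  · have (k : ℕ) : Vilenkin.dilTrans (F k) j n - Vilenkin.dilTrans f j n =
        Vilenkin.dilTrans (F k - f) j n := by
      funext x
      simp only [Vilenkin.dilTrans, Pi.sub_apply, mul_sub]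
    simp_rw [this, eLpNorm_dilTrans ((hF _).2.1.sub hf.1)]
    exact h1
  · have (k : ℕ) : fourierIntegral (Vilenkin.dilTrans (F k) j n) - modDil g j n =
        modDil (fourierIntegral (F k) - g) j n := by
      rw [fourierIntegral_dilTrans]
      funext x
      simp only [modDil, Pi.sub_apply, mul_sub]
    simp_rw [this, eLpNorm_modDil]
    exact h2

theorem modDil_zero (g : Vilenkin p → ℂ) (n : lattice p) :
    modDil g 0 n = fun ω => (starRingEnd ℂ) (chi (n : Vilenkin p) ω) * g ω := by
  funext x
  simp [modDil]

theorem dilTrans_ae_eq {f g : Vilenkin p → ℂ} (h : f =ᵐ[haar p] g) (j : ℤ) (n : lattice p) :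
    dilTrans f j n =ᵐ[haar p] dilTrans g j n := by
  filter_upwards [(quasiMeasurePreserving_dil_sub j n).ae_eq_comp h] with x hx
  simp only [dilTrans]
  exact congrArg _ hx

theorem inner_eq_inner_fourier {f g f' g' : Vilenkin p → ℂ} (h : IsFourierTransform f g)
    (h' : IsFourierTransform f' g') (hf : MemLp f 2 (haar p)) (hf' : MemLp f' 2 (haar p)) :
    inner ℂ (hf.toLp f) (hf'.toLp f') = ∫ ω, (starRingEnd ℂ) (g ω) * g' ω ∂haar p := by
  obtain ⟨_, hg, h1⟩ := isFourierTransform_iff.1 h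
  obtain ⟨_, hg', h2⟩ := isFourierTransform_iff.1 h'
  rw [← (fourierL2 p).inner_map_map, h1, h2, inner_toLp]

theorem isFourierTransform_fourierL2 (f : L2 p) :
    IsFourierTransform f (fourierL2 p f) :=
  isFourierTransform_iff.2 ⟨Lp.memLp _, Lp.memLp _, by rw [Lp.toLp_coeFn, Lp.toLp_coeFn]⟩

end Vilenkin

namespace Vilenkin

/-! ### Orthonormal systems in Hilbert spaces -/

section Hilbert

variable {H : Type*} [NormedAddCommGroup H] [InnerProductSpace ℂ H]
  {ι : Type*} {b : ι → H}

theorem mem_span_image_orthogonal_iff (J : Set ι) (f : H) :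
    f ∈ (Submodule.span ℂ (b '' J))ᗮ ↔ ∀ i ∈ J, inner ℂ (b i) f = 0 := by
  rw [Submodule.mem_orthogonal]
  constructor
  · intro h i hi
    exact h _ (Submodule.subset_span ⟨i, hi, rfl⟩)
  · intro h u hu
    induction hu using Submodule.span_induction with
    | mem x hx =>
      obtain ⟨i, hi, rfl⟩ := hx
      exact h i hi
    | zero => exact inner_zero_left _
    | add x y _ _ hx hy => rw [inner_add_left, hx, hy, add_zero]
    | smul a x _ hx => rw [inner_smul_left, hx, mul_zero]

variable [CompleteSpace H]

/-- A family is total in a closed subspace that contains it if only the zero vector of the subspace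
is orthogonal to the family. -/
theorem topologicalClosure_span_eq {M : Submodule ℂ H} (hM : IsClosed (M : Set H))
    (hb : ∀ i, b i ∈ M) (h0 : ∀ f ∈ M, (∀ i, inner ℂ (b i) f = 0) → f = 0) :
    (Submodule.span ℂ (Set.range b)).topologicalClosure = M := by
  set K := (Submodule.span ℂ (Set.range b)).topologicalClosure with hK
  have hKM : K ≤ M := Submodule.topologicalClosure_minimal _
    (Submodule.span_le.2 (Set.range_subset_iff.2 hb)) hM
  have : CompleteSpace K := (Submodule.isClosed_topologicalClosure _).completeSpace_coe
  rw [← Submodule.sup_orthogonal_inf_of_hasOrthogonalProjection hKM]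
  have : Kᗮ ⊓ M = ⊥ := by
    refine (Submodule.eq_bot_iff _).2 fun f hf => ?_
    obtain ⟨hf, hfM⟩ := Submodule.mem_inf.1 hf
    exact h0 f hfM fun i => Submodule.inner_right_of_mem_orthogonal
      (Submodule.le_topologicalClosure _ (Submodule.subset_span (Set.mem_range_self i))) hf
  rw [this, sup_bot_eq]

theorem eq_zero_of_inner_eq_zero (ht : (Submodule.span ℂ (Set.range b)).topologicalClosure = ⊤)
    {f : H} (hf : ∀ i, inner ℂ (b i) f = 0) : f = 0 := by
  rw [Submodule.topologicalClosure_eq_top_iff, Submodule.eq_bot_iff] at ht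
  refine ht f ((Submodule.mem_orthogonal _ _).2 fun u hu => ?_)
  induction hu using Submodule.span_induction with
  | mem x hx =>
    obtain ⟨i, rfl⟩ := hx
    exact hf i
  | zero => exact inner_zero_left _
  | add x y _ _ hx hy => rw [inner_add_left, hx, hy, add_zero]
  | smul a x _ hx => rw [inner_smul_left, hx, mul_zero]

/-- If every member of a total family lies either in the closed subspace `M` or in its orthogonal
complement, then those in `M` are total in `M`. -/
theorem topologicalClosure_span_image_eq
    (ht : (Submodule.span ℂ (Set.range b)).topologicalClosure = ⊤) {M : Submodule ℂ H}
    (hM : IsClosed (M : Set H)) (J : Set ι) (h1 : ∀ i ∈ J, b i ∈ M) (h2 : ∀ i ∉ J, b i ∈ Mᗮ) :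
    (Submodule.span ℂ (b '' J)).topologicalClosure = M := by
  rw [Set.image_eq_range]
  refine topologicalClosure_span_eq hM (fun i => h1 i i.2) fun f hf h => ?_
  refine eq_zero_of_inner_eq_zero ht fun i => ?_
  by_cases hi : i ∈ J
  · exact h ⟨i, hi⟩
  · exact Submodule.inner_left_of_mem_orthogonal hf (h2 i hi)

end Hilbert

variable {p : ℕ}

theorem dil_mem_lattice {k : ℤ} (hk : 0 ≤ k) {n : Vilenkin p} (hn : n ∈ lattice p) :
    dil k n ∈ lattice p := fun j hj => hn (j + k) (by omega)

variable [NeZero p]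

theorem IsOrthonormalBasis.isRieszBasis {ι : Type} {V : Submodule ℂ (L2 p)}
    {e : ι → Vilenkin p → ℂ} (h : IsOrthonormalBasis V e) : IsRieszBasis V e := by
  obtain ⟨he, ho, hs⟩ := h
  refine ⟨he, hs, 1, 1, one_pos, one_pos, fun β => ?_⟩
  have hsum := ho.orthogonalFamily.summable_of_lp β
  have heq := ho.orthogonalFamily.linearIsometry_apply β
  simp only [LinearIsometry.toSpanSingleton_apply] at hsum heq
  refine ⟨hsum, ?_⟩
  rw [← heq, LinearIsometry.norm_map, one_mul]
  exact ⟨le_rfl, le_rfl⟩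

/-! ### The ladder of spaces generated by a wavelet basis -/

section Ladder

variable {ψ : Idx p → Vilenkin p → ℂ} (hψ : ∀ u, MemLp (ψ u) 2 (haar p))

/-- The classes in `L²(G)` of the functions `ψ^{(u)}_{j,n}`. -/
noncomputable def waveletL2 (i : ℤ × lattice p × Idx p) : L2 p :=
  (memLp_dilTrans (hψ i.2.2) i.1 i.2.1).toLp _

/-- The space of all `f ∈ L²(G)` orthogonal to the functions `ψ^{(u)}_{k,n}` with `k ≥ m`. -/
noncomputable def ladder (m : ℤ) : Submodule ℂ (L2 p) :=
  (Submodule.span ℂ (waveletL2 hψ '' {i | m ≤ i.1}))ᗮ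

theorem mem_ladder {m : ℤ} {f : L2 p} :
    f ∈ ladder hψ m ↔ ∀ i : ℤ × lattice p × Idx p, m ≤ i.1 → inner ℂ (waveletL2 hψ i) f = 0 :=
  mem_span_image_orthogonal_iff _ _

theorem isClosed_ladder (m : ℤ) : IsClosed (ladder hψ m : Set (L2 p)) :=
  Submodule.isClosed_orthogonal _

theorem monotone_ladder : Monotone (ladder hψ) := fun _ _ hmk _ hf =>
  (mem_ladder hψ).2 fun i hi => (mem_ladder hψ).1 hf i (hmk.trans hi)

theorem waveletL2_mem_ladder_orthogonal {m : ℤ} {i : ℤ × lattice p × Idx p} (hi : m ≤ i.1) :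
    waveletL2 hψ i ∈ (ladder hψ m)ᗮ :=
  Submodule.le_orthogonal_orthogonal _ (Submodule.subset_span ⟨i, hi, rfl⟩)

theorem memSubspace_ladder_iff {m : ℤ} {f : Vilenkin p → ℂ} (hf : MemLp f 2 (haar p)) :
    MemSubspace (ladder hψ m) f ↔ ∀ i : ℤ × lattice p × Idx p, m ≤ i.1 →
      ∫ x, (starRingEnd ℂ) (dilTrans (ψ i.2.2) i.1 i.2.1 x) * f x ∂haar p = 0 := by
  have : MemSubspace (ladder hψ m) f ↔ hf.toLp f ∈ ladder hψ m :=
    ⟨fun ⟨_, h⟩ => h, fun h => ⟨hf, h⟩⟩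
  rw [this, mem_ladder]
  simp only [waveletL2, inner_toLp]

theorem memLp_comp_dil {f : Vilenkin p → ℂ} (hf : MemLp f 2 (haar p)) (m : ℤ) :
    MemLp (fun x => f (dil m x)) 2 (haar p) := by
  refine ⟨hf.1.comp_quasiMeasurePreserving (quasiMeasurePreserving_dil m), ?_⟩
  rw [eLpNorm_comp_dil]
  exact ENNReal.mul_lt_top ENNReal.ofReal_lt_top hf.2

theorem memLp_comp_sub {f : Vilenkin p → ℂ} (hf : MemLp f 2 (haar p)) (y : Vilenkin p) :
    MemLp (fun x => f (x - y)) 2 (haar p) :=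
  hf.comp_measurePreserving (measurePreserving_sub_right (haar p) y)

/-- `ψ^{(u)}_{j+1,n}` is, up to a constant, the dilate of `ψ^{(u)}_{j,n}`. -/
theorem memSubspace_ladder_dil {m : ℤ} {f : Vilenkin p → ℂ} (hf : MemLp f 2 (haar p)) :
    MemSubspace (ladder hψ m) f ↔ MemSubspace (ladder hψ (m + 1)) (fun x => f (dil 1 x)) := by
  have hp := natCast_pos_real (p := p)
  rw [memSubspace_ladder_iff hψ hf, memSubspace_ladder_iff hψ (memLp_comp_dil hf 1)]
  have key (j : ℤ) (n : lattice p) (u : Idx p) :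
      ∫ x, (starRingEnd ℂ) (dilTrans (ψ u) (j + 1) n x) * f (dil 1 x) ∂haar p = 0 ↔
      ∫ x, (starRingEnd ℂ) (dilTrans (ψ u) j n x) * f x ∂haar p = 0 := by
    have h1 : ∀ x, (starRingEnd ℂ) (dilTrans (ψ u) (j + 1) n x) * f (dil 1 x) =
        (((p : ℝ) ^ ((1 : ℝ) / 2) : ℝ) : ℂ) *
          (fun y => (starRingEnd ℂ) (dilTrans (ψ u) j n y) * f y) (dil 1 x) := fun x => by
      simp only [dilTrans, dil_dil, map_mul, Complex.conj_ofReal]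
      rw [Int.cast_add, Int.cast_one, add_div, Real.rpow_add hp, Complex.ofReal_mul]
      ring
    rw [integral_congr_ae (ae_of_all _ h1), integral_const_mul, integral_comp_dil 1 fun y =>
      (starRingEnd ℂ) (dilTrans (ψ u) j n y) * f y, mul_eq_zero, mul_eq_zero]
    have h2 : (((p : ℝ) ^ ((1 : ℝ) / 2) : ℝ) : ℂ) ≠ 0 := by
      exact_mod_cast (Real.rpow_pos_of_pos hp _).ne'
    have h3 : (((p : ℝ) ^ (-1 : ℤ) : ℝ) : ℂ) ≠ 0 := by
      exact_mod_cast (zpow_pos hp _).ne'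
    simp only [h2, h3, false_or]
  constructor
  · rintro h ⟨j, n, u⟩ hj
    have := (key (j - 1) n u).2 (h (j - 1, n, u) (by simp only at hj ⊢; omega))
    simpa only [sub_add_cancel] using this
  · rintro h ⟨j, n, u⟩ hj
    exact (key j n u).1 (h (j + 1, n, u) (by simp only at hj ⊢; omega))

/-- For `j ≥ 0` and `n ∈ Λ`, translation by `n` permutes the wavelets of index `j`, because
`ρ^j(n) ∈ Λ`. -/
theorem memSubspace_ladder_translate {f : Vilenkin p → ℂ} (hf : MemLp f 2 (haar p)) :
    MemSubspace (ladder hψ 0) f ↔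
      ∀ n : lattice p, MemSubspace (ladder hψ 0) (fun x => f (x - (n : Vilenkin p))) := by
  refine ⟨fun h n => ?_, fun h => by simpa using h 0⟩
  rw [memSubspace_ladder_iff hψ (memLp_comp_sub hf _)]
  rw [memSubspace_ladder_iff hψ hf] at h
  rintro ⟨j, m, u⟩ hj
  rw [← h (j, m - ⟨dil j n, dil_mem_lattice hj n.2⟩, u) hj,
    ← integral_add_right_eq_self _ (n : Vilenkin p)]
  refine integral_congr_ae (ae_of_all _ fun x => ?_)
  have h1 : dil j x + dil j (n : Vilenkin p) - (m : Vilenkin p) =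
      dil j x - ((m : Vilenkin p) - dil j (n : Vilenkin p)) := by abel
  simp only [dilTrans, add_sub_cancel_right, dil_add, AddSubgroup.coe_sub, h1]

variable {hψ} (ho : Orthonormal ℂ (waveletL2 hψ))
  (ht : (Submodule.span ℂ (Set.range (waveletL2 hψ))).topologicalClosure = ⊤)

include ho in
theorem waveletL2_mem_ladder {m : ℤ} {i : ℤ × lattice p × Idx p} (hi : i.1 < m) :
    waveletL2 hψ i ∈ ladder hψ m :=
  (mem_ladder hψ).2 fun k hk => ho.2 (by rintro rfl; omega)

include ho ht in
theorem dense_iUnion_ladder : Dense (⋃ j, (ladder hψ j : Set (L2 p))) := by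
  have hd : Directed (· ≤ ·) (ladder hψ) := (monotone_ladder hψ).directed_le
  rw [← Submodule.coe_iSup_of_directed _ hd, Submodule.dense_iff_topologicalClosure_eq_top,
    eq_top_iff, ← ht]
  refine Submodule.topologicalClosure_mono (Submodule.span_le.2 ?_)
  rintro _ ⟨i, rfl⟩
  exact Submodule.mem_iSup_of_mem (i.1 + 1) (waveletL2_mem_ladder ho (by omega))

include ht in
theorem iInter_ladder : (⋂ j, (ladder hψ j : Set (L2 p))) = {0} := by
  refine Set.eq_singleton_iff_unique_mem.2 ⟨Set.mem_iInter.2 fun j => zero_mem _, fun f hf => ?_⟩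
  refine eq_zero_of_inner_eq_zero ht fun i => ?_
  exact (mem_ladder hψ).1 (Set.mem_iInter.1 hf i.1) i le_rfl

include ho ht in
theorem isAssociated_ladder : IsAssociated ψ (ladder hψ) := by
  intro j
  refine ⟨fun i => memLp_dilTrans (hψ i.2) j i.1,
    ho.comp (fun i : lattice p × Idx p => (j, i)) fun _ _ h => (Prod.mk.inj h).2, ?_⟩
  have h : (Set.range fun i : lattice p × Idx p =>
      (memLp_dilTrans (hψ i.2) j i.1).toLp (dilTrans (ψ i.2) j i.1)) =
      waveletL2 hψ '' {i | i.1 = j} := by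
    ext f
    constructor
    · rintro ⟨i, rfl⟩
      exact ⟨(j, i), rfl, rfl⟩
    · rintro ⟨⟨_, i⟩, rfl, rfl⟩
      exact ⟨i, rfl⟩
  rw [h]
  refine topologicalClosure_span_image_eq ht
    ((isClosed_ladder hψ _).inter (Submodule.isClosed_orthogonal _)) _ ?_ ?_
  · rintro i (rfl : i.1 = j)
    exact ⟨waveletL2_mem_ladder ho (by omega), waveletL2_mem_ladder_orthogonal hψ le_rfl⟩
  · intro i (hi : i.1 ≠ j)
    rcases lt_or_gt_of_ne hi with h | h
    · exact Submodule.orthogonal_le inf_le_right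
        (Submodule.le_orthogonal_orthogonal _ (waveletL2_mem_ladder ho h))
    · exact Submodule.orthogonal_le inf_le_left (waveletL2_mem_ladder_orthogonal hψ (by omega))

include ho ht in
/-- The central space of an MRA is determined by the associated wavelets: it is the closed span of
those with `j < 0`. -/
theorem eq_ladder_of_isAssociated {V : ℤ → Submodule ℂ (L2 p)} (hV : IsMRA V)
    (ha : IsAssociated ψ V) : V 0 = ladder hψ 0 := by
  have hmem (i : ℤ × lattice p × Idx p) : waveletL2 hψ i ∈ V (i.1 + 1) ⊓ (V i.1)ᗮ := by
    obtain ⟨h, -, hs⟩ := ha i.1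
    rw [← hs]
    exact Submodule.le_topologicalClosure _ (Submodule.subset_span ⟨i.2, rfl⟩)
  rw [← topologicalClosure_span_image_eq ht (hV.isClosed 0) {i | i.1 < 0},
    ← topologicalClosure_span_image_eq ht (isClosed_ladder hψ 0) {i | i.1 < 0}]
  · exact fun i hi => waveletL2_mem_ladder ho hi
  · exact fun i hi => waveletL2_mem_ladder_orthogonal hψ (not_lt.1 hi)
  · exact fun i (hi : i.1 < 0) => hV.increasing (by omega : i.1 + 1 ≤ 0) (hmem i).1
  · exact fun i hi => Submodule.orthogonal_le (hV.increasing (not_lt.1 hi)) (hmem i).2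

end Ladder

end Vilenkin

namespace Vilenkin

variable {p : ℕ}

/-! ### The tiles of a wavelet set -/

theorem measurableSet_image_dil {E : Set (Vilenkin p)} (hE : MeasurableSet E) (m : ℤ) :
    MeasurableSet (dil m '' E) := by
  rw [dil_image_eq_preimage]
  exact measurable_dil _ hE

/-- `Ω_Σ` as a countable union over one index type; `j ≥ 1` is written as `j + 1`. -/
theorem sigmaUnion_eq (Ω : Idx p → Set (VilenkinDual p)) :
    sigmaUnion Ω = ⋃ q : Idx p × ℕ, dil (-((q.2 : ℤ) + 1)) '' Ω q.1 := by
  ext ω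
  simp only [sigmaUnion, Set.mem_iUnion]
  constructor
  · rintro ⟨u, j, hj, h⟩
    refine ⟨(u, j - 1), ?_⟩
    rwa [show ((j - 1 : ℕ) : ℤ) + 1 = j by omega]
  · rintro ⟨⟨u, j⟩, h⟩
    exact ⟨u, j + 1, by omega, by push_cast; exact h⟩

theorem tile_subset_sigmaUnion (Ω : Idx p → Set (VilenkinDual p)) {j : ℤ} (hj : j < 0)
    (u : Idx p) : dil j '' Ω u ⊆ sigmaUnion Ω := by
  rw [sigmaUnion_eq]
  refine Set.subset_iUnion_of_subset (u, (-j - 1).toNat) ?_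
  rw [show -(((-j - 1).toNat : ℤ) + 1) = j by omega]

theorem measurableSet_sigmaUnion {Ω : Idx p → Set (VilenkinDual p)}
    (hm : ∀ u, MeasurableSet (Ω u)) : MeasurableSet (sigmaUnion Ω) := by
  rw [sigmaUnion_eq]
  exact MeasurableSet.iUnion fun q => measurableSet_image_dil (hm _) _

variable [NeZero p]

theorem memLp_indicator_one {E : Set (Vilenkin p)} (hE : MeasurableSet E) (hfin : haar p E < ⊤) :
    MemLp (E.indicator fun _ => (1 : ℂ)) 2 (haar p) :=
  memLp_indicator_const 2 hE 1 (Or.inr hfin.ne)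

theorem haar_image_dil_lt_top {E : Set (Vilenkin p)} (hfin : haar p E < ⊤) (m : ℤ) :
    haar p (dil m '' E) < ⊤ := by
  rw [haar_image_dil]
  exact ENNReal.mul_lt_top
    (ENNReal.zpow_lt_top natCast_ne_zero (ENNReal.natCast_ne_top p) _) hfin

theorem modDil_indicator_of_notMem {E : Set (Vilenkin p)} {j : ℤ} {ω : Vilenkin p}
    (h : ω ∉ dil j '' E) (n : lattice p) : modDil (E.indicator fun _ => 1) j n ω = 0 := by
  rw [dil_image_eq_preimage] at h
  simp [modDil, Set.indicator_of_notMem (show dil (-j) ω ∉ E from h)]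

theorem modDil_indicator_zero (E : Set (Vilenkin p)) (j : ℤ) :
    modDil (E.indicator fun _ => 1) j 0 =
      fun ω => (((p : ℝ) ^ (-(j : ℝ) / 2) : ℝ) : ℂ) * (dil j '' E).indicator (fun _ => 1) ω := by
  funext ω
  rw [dil_image_eq_preimage]
  simp only [modDil, AddSubgroup.coe_zero, chi_zero_left, map_one, one_mul, Set.indicator,
    Set.mem_preimage]
  rfl

section Tiles

variable {Ω : Idx p → Set (VilenkinDual p)} (hm : ∀ u, MeasurableSet (Ω u))
  (hfin : ∀ u, haar p (Ω u) < ⊤) {ψ : Idx p → Vilenkin p → ℂ}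
  (hψ : ∀ u, IsFourierTransform (ψ u) ((Ω u).indicator fun _ => 1))
  {hψ2 : ∀ u, MemLp (ψ u) 2 (haar p)} (ho : Orthonormal ℂ (waveletL2 hψ2))
  (ht : (Submodule.span ℂ (Set.range (waveletL2 hψ2))).topologicalClosure = ⊤)

include hm hψ in
/-- For `n = 0` there is no modulation, so the inner product of two wavelets is the measure of the
intersection of their tiles, up to a positive factor. -/
theorem inner_waveletL2_zero (j k : ℤ) (u v : Idx p) :
    inner ℂ (waveletL2 hψ2 (j, 0, u)) (waveletL2 hψ2 (k, 0, v)) =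
      (((p : ℝ) ^ (-(j : ℝ) / 2) * (p : ℝ) ^ (-(k : ℝ) / 2) *
        (haar p).real (dil j '' Ω u ∩ dil k '' Ω v) : ℝ) : ℂ) := by
  rw [waveletL2, waveletL2,
    inner_eq_inner_fourier ((hψ u).dilTrans j 0) ((hψ v).dilTrans k 0)]
  have h (ω : Vilenkin p) : (starRingEnd ℂ) (modDil ((Ω u).indicator fun _ => 1) j 0 ω) *
      modDil ((Ω v).indicator fun _ => 1) k 0 ω =
      (((p : ℝ) ^ (-(j : ℝ) / 2) * (p : ℝ) ^ (-(k : ℝ) / 2) : ℝ) : ℂ) *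
        (dil j '' Ω u ∩ dil k '' Ω v).indicator (fun _ => 1) ω := by
    simp only [modDil_indicator_zero, map_mul, Complex.conj_ofReal, Complex.ofReal_mul]
    have h3 : (dil j '' Ω u ∩ dil k '' Ω v).indicator (fun _ => (1 : ℂ)) ω =
        (starRingEnd ℂ) ((dil j '' Ω u).indicator (fun _ => 1) ω) *
          (dil k '' Ω v).indicator (fun _ => 1) ω := by
      by_cases h1 : ω ∈ dil j '' Ω u
      · by_cases h2 : ω ∈ dil k '' Ω v
        · rw [Set.indicator_of_mem h1, Set.indicator_of_mem h2,
            Set.indicator_of_mem (Set.mem_inter h1 h2), map_one, one_mul]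
        · rw [Set.indicator_of_notMem h2, mul_zero,
            Set.indicator_of_notMem fun h => h2 (Set.mem_of_mem_inter_right h)]
      · rw [Set.indicator_of_notMem h1, map_zero, zero_mul,
          Set.indicator_of_notMem fun h => h1 (Set.mem_of_mem_inter_left h)]
    rw [h3]
    ring
  rw [integral_congr_ae (ae_of_all _ h), integral_const_mul, integral_indicator_const _
    ((measurableSet_image_dil (hm u) j).inter (measurableSet_image_dil (hm v) k))]
  simp

include hm hfin hψ ho in
/-- The dilates of the sets of a wavelet set are pairwise almost disjoint, as the wavelets are
orthogonal. -/
theorem haar_tile_inter_tile {j k : ℤ} {u v : Idx p} (h : (j, u) ≠ (k, v)) :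
    haar p (dil j '' Ω u ∩ dil k '' Ω v) = 0 := by
  have hp := natCast_pos_real (p := p)
  have h1 : inner ℂ (waveletL2 hψ2 (j, 0, u)) (waveletL2 hψ2 (k, 0, v)) = 0 :=
    ho.2 fun h2 => h (by simpa using h2)
  rw [inner_waveletL2_zero hm hψ] at h1
  have h2 := (mul_eq_zero.1 (Complex.ofReal_eq_zero.1 h1)).resolve_left (by positivity)
  exact (measureReal_eq_zero_iff
    ((measure_mono Set.inter_subset_left).trans_lt (haar_image_dil_lt_top (hfin u) j)).ne).1 h2

include hm hψ ho in
theorem haar_waveletSet (u : Idx p) : haar p (Ω u) = 1 := by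
  have h1 : inner ℂ (waveletL2 hψ2 (0, 0, u)) (waveletL2 hψ2 (0, 0, u)) = (1 : ℂ) := by
    rw [inner_self_eq_norm_sq_to_K, ho.1]
    simp
  rw [inner_waveletL2_zero hm hψ] at h1
  have h2 := Complex.ofReal_eq_one.1 h1
  have h3 : dil 0 '' Ω u = Ω u := by
    rw [funext dil_zero_index]
    exact Set.image_id _
  rw [h3, Set.inter_self] at h2
  simp only [Int.cast_zero, neg_zero, zero_div, Real.rpow_zero, one_mul] at h2
  exact (ENNReal.toReal_eq_one_iff _).1 h2

include hm hfin hψ ho in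
theorem haar_tile_inter_sigmaUnion {j : ℤ} (hj : 0 ≤ j) (u : Idx p) :
    haar p (dil j '' Ω u ∩ sigmaUnion Ω) = 0 := by
  rw [sigmaUnion_eq, Set.inter_iUnion, measure_iUnion_null_iff]
  intro q
  refine haar_tile_inter_tile hm hfin hψ ho fun h => ?_
  have := (Prod.mk.inj h).1
  omega

include hm hfin hψ ho in
/-- The measure of `Ω_Σ` is `(p - 1) ∑_{j ≥ 1} p^{-j} = 1`. -/
theorem haar_sigmaUnion (hp : 2 ≤ p) : haar p (sigmaUnion Ω) = 1 := by
  have hp0 := natCast_ne_zero (p := p)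
  have hpt := ENNReal.natCast_ne_top p
  rw [sigmaUnion_eq, measure_iUnion₀]
  · simp only [haar_image_dil, haar_waveletSet hm hψ ho, mul_one]
    rw [ENNReal.tsum_prod (f := fun (_ : Idx p) (j : ℕ) => (p : ENNReal) ^ (-((j : ℤ) + 1))),
      tsum_fintype]
    have h1 (j : ℕ) : (p : ENNReal) ^ (-((j : ℤ) + 1)) =
        (p : ENNReal)⁻¹ * ((p : ENNReal)⁻¹) ^ j := by
      rw [neg_add, ENNReal.zpow_add hp0 hpt, zpow_neg_one, mul_comm, ENNReal.zpow_neg,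
        zpow_natCast, ENNReal.inv_pow]
    simp_rw [h1, ENNReal.tsum_mul_left, ENNReal.tsum_geometric]
    rw [Finset.sum_const, Finset.card_univ, Fintype.card_coe, Nat.card_Icc, nsmul_eq_mul,
      ← ENNReal.mul_inv (Or.inl hp0) (Or.inl hpt), ENNReal.mul_sub (fun _ _ => hpt), mul_one,
      ENNReal.mul_inv_cancel hp0 hpt, Nat.add_sub_cancel, ENNReal.natCast_sub, Nat.cast_one]
    refine ENNReal.mul_inv_cancel ?_ (ENNReal.sub_ne_top hpt)
    rw [ne_eq, tsub_eq_zero_iff_le, not_le]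
    exact_mod_cast hp
  · intro q q' hq
    refine haar_tile_inter_tile hm hfin hψ ho fun h => hq ?_
    obtain ⟨h1, h2⟩ := Prod.mk.inj h
    exact Prod.ext h2 (by omega)
  · exact fun q => (measurableSet_image_dil (hm _) _).nullMeasurableSet

include hψ in
theorem inner_waveletL2_eq_integral (i : ℤ × lattice p × Idx p) {f g : Vilenkin p → ℂ}
    (h : IsFourierTransform f g) (hf : MemLp f 2 (haar p)) :
    inner ℂ (waveletL2 hψ2 i) (hf.toLp f) = ∫ ω, (starRingEnd ℂ)
      (modDil ((Ω i.2.2).indicator fun _ => 1) i.1 i.2.1 ω) * g ω ∂haar p :=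
  inner_eq_inner_fourier ((hψ i.2.2).dilTrans i.1 i.2.1) h _ hf

include hm hfin hψ ho ht in
/-- The Fourier transform maps the central space of the ladder onto `L²(Ω_Σ)`. -/
theorem mem_ladder_zero_iff {f g : Vilenkin p → ℂ} (h : IsFourierTransform f g)
    (hf : MemLp f 2 (haar p)) :
    hf.toLp f ∈ ladder hψ2 0 ↔ ∀ᵐ ω ∂haar p, ω ∉ sigmaUnion Ω → g ω = 0 := by
  have hS := measurableSet_sigmaUnion hm
  have hnull {j : ℤ} (hj : 0 ≤ j) (u : Idx p) : ∀ᵐ ω ∂haar p,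
      ω ∉ dil j '' Ω u ∩ sigmaUnion Ω :=
    measure_eq_zero_iff_ae_notMem.1 (haar_tile_inter_sigmaUnion hm hfin hψ ho hj u)
  rw [mem_ladder]
  constructor
  · intro h0
    -- the part of `g` off `Ω_Σ` is orthogonal to all wavelets
    have hg' : MemLp ((sigmaUnion Ω)ᶜ.indicator g) 2 (haar p) := h.2.1.indicator hS.compl
    obtain ⟨f', hf'⟩ := exists_isFourierTransform hg'
    have hz : hf'.1.toLp f' = 0 := by
      refine eq_zero_of_inner_eq_zero ht fun i => ?_
      rw [inner_waveletL2_eq_integral hψ i hf']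
      rcases lt_or_ge i.1 0 with hi | hi
      · rw [integral_eq_zero_of_ae]
        refine ae_of_all _ fun ω => ?_
        by_cases hω : ω ∈ sigmaUnion Ω
        · simp [hω]
        · simp [modDil_indicator_of_notMem fun h => hω (tile_subset_sigmaUnion Ω hi _ h)]
      · rw [← h0 i hi, inner_waveletL2_eq_integral hψ i h]
        refine integral_congr_ae ?_
        filter_upwards [hnull hi i.2.2] with ω hω
        by_cases h1 : ω ∈ dil i.1 '' Ω i.2.2
        · rw [Set.indicator_of_mem (show ω ∈ (sigmaUnion Ω)ᶜ from fun h2 => hω ⟨h1, h2⟩)]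
        · simp [modDil_indicator_of_notMem h1]
    obtain ⟨_, h2, h3⟩ := isFourierTransform_iff.1 hf'
    rw [hz, map_zero] at h3
    have h4 : (sigmaUnion Ω)ᶜ.indicator g =ᵐ[haar p] 0 :=
      h2.coeFn_toLp.symm.trans (by rw [← h3]; exact Lp.coeFn_zero _ _ _)
    filter_upwards [h4] with ω h5 h6
    rwa [Set.indicator_of_mem (show ω ∈ (sigmaUnion Ω)ᶜ from h6)] at h5
  · intro h0 i hi
    rw [inner_waveletL2_eq_integral hψ i h, integral_eq_zero_of_ae]
    filter_upwards [hnull hi i.2.2, h0] with ω h1 h2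
    by_cases h3 : ω ∈ dil i.1 '' Ω i.2.2
    · simp [h2 fun h4 => h1 ⟨h3, h4⟩]
    · simp [modDil_indicator_of_notMem h3]

end Tiles

end Vilenkin

namespace Vilenkin

variable {p : ℕ} [NeZero p]

/-! ### Fundamental domains of `Λ` -/

theorem isAddFundamentalDomain_U : IsAddFundamentalDomain (lattice p) (U p) (haar p) := by
  refine IsAddFundamentalDomain.mk' measurableSet_U.nullMeasurableSet fun x => ?_
  have hx : -intPart x +ᵥ x = x - (intPart x : Vilenkin p) := by
    rw [AddSubgroup.vadd_def, vadd_eq_add, AddSubgroup.coe_neg, neg_add_eq_sub]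
  refine ⟨-intPart x, ?_, fun n hn => ?_⟩
  · simp only [hx]
    exact sub_intPart_mem_U x
  · have h1 : x - ((-n : lattice p) : Vilenkin p) ∈ U p := by
      rw [AddSubgroup.coe_neg, sub_neg_eq_add, add_comm]
      exact hn
    rw [eq_of_sub_mem_U (sub_intPart_mem_U x) h1, neg_neg]

open scoped Pointwise in
/-- A set of measure one whose translates by `Λ` are almost disjoint is a fundamental domain. -/
theorem isAddFundamentalDomain_of_haar_eq_one {E : Set (Vilenkin p)} (hE : MeasurableSet E)
    (h1 : haar p E = 1)
    (hdisj : ∀ n : lattice p, n ≠ 0 → haar p (E ∩ (fun ω => ω + (n : Vilenkin p)) '' E) = 0) :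
    IsAddFundamentalDomain (lattice p) E (haar p) := by
  have hvadd (n : lattice p) : n +ᵥ E = (fun ω => ω + (n : Vilenkin p)) '' E := by
    ext x
    simp only [Set.mem_vadd_set, Set.mem_image, AddSubgroup.vadd_def, vadd_eq_add, add_comm]
  have hdisj' : Pairwise (Function.onFun (AEDisjoint (haar p)) fun n : lattice p => n +ᵥ E) :=
    Measure.pairwise_aedisjoint_of_aedisjoint_forall_ne_zero
      (fun n hn => by rw [AEDisjoint, Set.inter_comm, hvadd]; exact hdisj n hn)
      (fun n => (measurePreserving_vadd n (haar p)).quasiMeasurePreserving)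
  have hm (n : lattice p) : MeasurableSet (n +ᵥ E) := hE.const_vadd n
  refine ⟨hE.nullMeasurableSet, ?_, hdisj'⟩
  set P : Set (Vilenkin p) := ⋃ n : lattice p, n +ᵥ E with hP
  have hPm : MeasurableSet P := MeasurableSet.iUnion hm
  -- the pieces of `E` in the cosets of `U`, moved to `U`, are almost disjoint and fill `U`
  have h2 : haar p (P ∩ U p) = 1 := by
    rw [← h1, isAddFundamentalDomain_U.measure_eq_tsum E, hP, Set.iUnion_inter, measure_iUnion₀]
    · exact fun m n hmn => (hdisj' hmn).mono Set.inter_subset_left Set.inter_subset_left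
    · exact fun n => ((hm n).inter measurableSet_U).nullMeasurableSet
  have h3 : haar p (Pᶜ ∩ U p) = 0 := by
    have := measure_inter_add_sdiff (μ := haar p) (U p) hPm
    rw [Set.inter_comm, h2, haar_U] at this
    rw [Set.inter_comm]
    have h4 : (1 : ENNReal) + haar p (U p \ P) = 1 + 0 := by rw [this, add_zero]
    exact (ENNReal.add_right_inj (by simp)).1 h4
  have h4 : haar p Pᶜ = 0 := by
    refine isAddFundamentalDomain_U.measure_zero_of_invariant _ (fun n => ?_) h3
    rw [Set.vadd_set_compl, hP, Set.vadd_set_iUnion]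
    simp_rw [vadd_vadd]
    exact congrArg compl
      ((Equiv.addLeft n).surjective.iUnion_comp fun m : lattice p => m +ᵥ E)
  filter_upwards [measure_eq_zero_iff_ae_notMem.1 h4] with x hx
  rw [Set.notMem_compl_iff, hP, Set.mem_iUnion] at hx
  obtain ⟨n, hn⟩ := hx
  exact ⟨-n, Set.mem_vadd_set_iff_neg_vadd_mem.1 hn⟩

/-! ### Translates of a scaling function -/

theorem IsFourierTransform.translate {f g : Vilenkin p → ℂ} (h : IsFourierTransform f g)
    (n : lattice p) : IsFourierTransform (fun x => f (x - (n : Vilenkin p)))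
      (fun ω => (starRingEnd ℂ) (chi (n : Vilenkin p) ω) * g ω) := by
  simpa only [dilTrans_zero, modDil_zero] using h.dilTrans 0 n

theorem integral_chi_eq_of_isAddFundamentalDomain {E : Set (Vilenkin p)}
    (hE : IsAddFundamentalDomain (lattice p) E (haar p)) (n : lattice p) [Decidable (n = 0)] :
    ∫ ω in E, chi (n : Vilenkin p) ω ∂haar p = if n = 0 then 1 else 0 := by
  classical
  rw [hE.setIntegral_eq isAddFundamentalDomain_U]
  · simp_rw [chi_comm (n : Vilenkin p)]
    rw [integral_U_chi]
    refine if_congr ⟨fun h => ?_, ?_⟩ rfl rfl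
    · exact Subtype.ext (eq_zero_of_mem_lattice_of_mem_U n.2 h)
    · rintro rfl
      exact fun _ _ => rfl
  · intro m ω
    rw [AddSubgroup.vadd_def, vadd_eq_add, chi_add_right, chi_lattice_lattice n.2 m.2, one_mul]

section Scaling

variable {Ω : Idx p → Set (VilenkinDual p)} (hm : ∀ u, MeasurableSet (Ω u))
  (hfin : ∀ u, haar p (Ω u) < ⊤) {ψ : Idx p → Vilenkin p → ℂ}
  (hψ : ∀ u, IsFourierTransform (ψ u) ((Ω u).indicator fun _ => 1))
  {hψ2 : ∀ u, MemLp (ψ u) 2 (haar p)} (ho : Orthonormal ℂ (waveletL2 hψ2))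
  (ht : (Submodule.span ℂ (Set.range (waveletL2 hψ2))).topologicalClosure = ⊤)

include hm hfin hψ ho ht in
/-- If `Ω_Σ` tiles the dual group by `Λ`-translates, the inverse transform of its indicator is an
orthonormal scaling function of the ladder. -/
theorem isOrthonormalBasis_translates (h1 : haar p (sigmaUnion Ω) = 1)
    (hdisj : ∀ n : lattice p, n ≠ 0 →
      haar p (sigmaUnion Ω ∩ (fun ω => ω + (n : Vilenkin p)) '' sigmaUnion Ω) = 0)
    {φ : Vilenkin p → ℂ} (hφ : IsFourierTransform φ ((sigmaUnion Ω).indicator fun _ => 1)) :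
    IsOrthonormalBasis (ladder hψ2 0) (fun (n : lattice p) x => φ (x - (n : Vilenkin p))) := by
  classical
  have hS := measurableSet_sigmaUnion hm
  have hdom := isAddFundamentalDomain_of_haar_eq_one hS h1 hdisj
  refine ⟨fun n => memLp_comp_sub hφ.1 _, ?_, ?_⟩
  · rw [orthonormal_iff_ite]
    intro m n
    rw [inner_eq_inner_fourier (hφ.translate m) (hφ.translate n)]
    have h2 (ω : Vilenkin p) : (starRingEnd ℂ) ((starRingEnd ℂ) (chi (m : Vilenkin p) ω) *
        (sigmaUnion Ω).indicator (fun _ => 1) ω) * ((starRingEnd ℂ) (chi (n : Vilenkin p) ω) *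
        (sigmaUnion Ω).indicator (fun _ => 1) ω) =
        (sigmaUnion Ω).indicator (fun ω => chi ((m - n : lattice p) : Vilenkin p) ω) ω := by
      by_cases hω : ω ∈ sigmaUnion Ω
      · simp only [Set.indicator_of_mem hω, mul_one, Complex.conj_conj]
        rw [AddSubgroup.coe_sub, sub_eq_add_neg, chi_add_left, chi_neg_left]
      · simp only [Set.indicator_of_notMem hω, mul_zero]
    rw [integral_congr_ae (ae_of_all _ h2), integral_indicator hS,
      integral_chi_eq_of_isAddFundamentalDomain hdom]
    simp only [sub_eq_zero]
  · refine topologicalClosure_span_eq (isClosed_ladder hψ2 0) (fun n => ?_) fun f hf h2 => ?_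
    · rw [mem_ladder_zero_iff hm hfin hψ ho ht (hφ.translate n)]
      exact ae_of_all _ fun ω hω => by simp [hω]
    · have hff := isFourierTransform_fourierL2 f
      set g := fourierL2 p f with hg
      have hsupp : ∀ᵐ ω ∂haar p, ω ∉ sigmaUnion Ω → g ω = 0 := by
        rw [← mem_ladder_zero_iff hm hfin hψ ho ht hff (Lp.memLp f), Lp.toLp_coeFn]
        exact hf
      have hfinS : IsFiniteMeasure ((haar p).restrict (sigmaUnion Ω)) := ⟨by simp [h1]⟩
      have hind : (sigmaUnion Ω).indicator g =ᵐ[haar p] g := by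
        filter_upwards [hsupp] with ω hω
        by_cases h3 : ω ∈ sigmaUnion Ω
        · rw [Set.indicator_of_mem h3]
        · rw [Set.indicator_of_notMem h3, hω h3]
      have hint : Integrable g (haar p) := by
        refine Integrable.congr ?_ hind
        rw [integrable_indicator_iff hS]
        exact ((Lp.memLp g).restrict _).integrable (by norm_num)
      have h3 : g =ᵐ[haar p] (0 : Vilenkin p → ℂ) := by
        refine ae_eq_zero_of_integral_mul_chi_eq_zero hint hS hdisj hsupp fun n hn => ?_
        have h4 := h2 ⟨n, hn⟩
        rw [← Lp.toLp_coeFn f (Lp.memLp f),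
          inner_eq_inner_fourier (hφ.translate ⟨n, hn⟩) hff] at h4
        rw [← h4]
        refine integral_congr_ae ?_
        filter_upwards [hsupp] with ω hω
        by_cases h5 : ω ∈ sigmaUnion Ω
        · simp only [Set.indicator_of_mem h5, mul_one, Complex.conj_conj]
          exact mul_comm _ _
        · rw [hω h5, zero_mul, mul_zero]
      rw [← LinearIsometryEquiv.map_eq_zero_iff (fourierL2 p), ← hg]
      exact Lp.eq_zero_iff_ae_eq_zero.2 h3

include hm hfin hψ ho ht in
/-- If the translates of `φ` are total in the central space of the ladder, a function supported on
`Ω_Σ` that is orthogonal to all modulations of `G`, the Fourier transform of `φ`, vanishes. -/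
theorem ae_eq_zero_of_orthogonal_translates {φ G : Vilenkin p → ℂ} (hφ : IsFourierTransform φ G)
    (hφ2 : ∀ n : lattice p, MemLp (fun x => φ (x - (n : Vilenkin p))) 2 (haar p))
    (hspan : (Submodule.span ℂ (Set.range fun n : lattice p => (hφ2 n).toLp
      fun x => φ (x - (n : Vilenkin p)))).topologicalClosure = ladder hψ2 0)
    {v : Vilenkin p → ℂ} (hv : MemLp v 2 (haar p))
    (hsupp : ∀ ω, ω ∉ sigmaUnion Ω → v ω = 0)
    (h0 : ∀ n : lattice p,
      ∫ ω, chi (n : Vilenkin p) ω * ((starRingEnd ℂ) (G ω) * v ω) ∂haar p = 0) :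
    v =ᵐ[haar p] 0 := by
  obtain ⟨f, hf⟩ := exists_isFourierTransform hv
  have hfV : hf.1.toLp f ∈ ladder hψ2 0 :=
    (mem_ladder_zero_iff hm hfin hψ ho ht hf hf.1).2 (ae_of_all _ hsupp)
  have hforth : hf.1.toLp f ∈ (ladder hψ2 0)ᗮ := by
    rw [← hspan, Submodule.orthogonal_closure, ← Set.image_univ, mem_span_image_orthogonal_iff]
    intro n _
    rw [inner_eq_inner_fourier (hφ.translate n) hf, ← h0 n]
    refine integral_congr_ae (ae_of_all _ fun ω => ?_)
    simp only [map_mul, Complex.conj_conj, mul_assoc]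
  have hz : hf.1.toLp f = 0 := by
    rw [← inner_self_eq_zero (𝕜 := ℂ)]
    exact Submodule.inner_right_of_mem_orthogonal hfV hforth
  obtain ⟨_, h2, h3⟩ := isFourierTransform_iff.1 hf
  rw [hz, map_zero] at h3
  exact h2.coeFn_toLp.symm.trans (by rw [← h3]; exact Lp.coeFn_zero _ _ _)

include hm hfin hψ ho ht in
/-- If `L²(Ω_Σ)` is generated by the modulations `χ(n, ·) G`, `n ∈ Λ`, of one function, then the
translates of `Ω_Σ` by `Λ` are almost disjoint. -/
theorem haar_sigmaUnion_inter_translate {φ : Vilenkin p → ℂ}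
    (h1 : haar p (sigmaUnion Ω) = 1)
    (hφ2 : ∀ n : lattice p, MemLp (fun x => φ (x - (n : Vilenkin p))) 2 (haar p))
    (hspan : (Submodule.span ℂ (Set.range fun n : lattice p => (hφ2 n).toLp
      fun x => φ (x - (n : Vilenkin p)))).topologicalClosure = ladder hψ2 0)
    {k : lattice p} (hk : k ≠ 0) :
    haar p (sigmaUnion Ω ∩ (fun ω => ω + (k : Vilenkin p)) '' sigmaUnion Ω) = 0 := by
  have hS := measurableSet_sigmaUnion hm
  have hφ : MemLp φ 2 (haar p) := by simpa using hφ2 0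
  set G : Vilenkin p → ℂ := ⇑(fourierL2 p (hφ.toLp φ)) with hG
  have hφG : IsFourierTransform φ G :=
    isFourierTransform_iff.2 ⟨hφ, Lp.memLp _, by rw [Lp.toLp_coeFn]⟩
  have hGm : MemLp G 2 (haar p) := hφG.2.1
  set A := sigmaUnion Ω ∩ (fun ω => ω + (k : Vilenkin p)) '' sigmaUnion Ω with hA
  have hAm : MeasurableSet A :=
    hS.inter ((MeasurableEquiv.addRight (k : Vilenkin p)).measurableSet_image.2 hS)
  have hcover : A = ⋃ m : lattice p, A ∩ cell m := by
    rw [← Set.inter_iUnion, Set.inter_eq_left.2]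
    exact fun ω _ => Set.mem_iUnion.2 ⟨intPart ω, mem_cell_intPart ω⟩
  rw [hcover, measure_iUnion_null_iff]
  intro m
  set B := A ∩ cell m with hB
  have hBm : MeasurableSet B := hAm.inter (measurableSet_cell m)
  have hBS {ω : Vilenkin p} (h : ω ∈ B) : ω ∈ sigmaUnion Ω := h.1.1
  have hBS' {ω : Vilenkin p} (h : ω + (k : Vilenkin p) ∈ B) : ω ∈ sigmaUnion Ω := by
    obtain ⟨η, hη, h2⟩ := h.1.2
    rwa [← add_right_cancel h2]
  -- `B` and its translate by `k` are disjoint, since `B` is contained in one coset of `U`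
  have hBB {ω : Vilenkin p} (h : ω ∈ B) (h' : ω + (k : Vilenkin p) ∈ B) : False := by
    have h2 : ω + (k : Vilenkin p) ∈
        cell m ∩ (fun x => x + (k : Vilenkin p)) '' cell m := ⟨h'.2, ω, h.2, rfl⟩
    rw [cell_inter_translate_eq_empty m k hk] at h2
    exact h2
  have hfinB : haar p B < ⊤ :=
    (measure_mono (fun _ h => hBS h)).trans_lt (by rw [h1]; exact ENNReal.one_lt_top)
  have key {v : Vilenkin p → ℂ} (hv : MemLp v 2 (haar p))
      (hsupp : ∀ ω, ω ∉ sigmaUnion Ω → v ω = 0) (h0 : ∀ n : lattice p,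
        ∫ ω, chi (n : Vilenkin p) ω * ((starRingEnd ℂ) (G ω) * v ω) ∂haar p = 0) :
      v =ᵐ[haar p] 0 :=
    ae_eq_zero_of_orthogonal_translates hm hfin hψ ho ht hφG hφ2 hspan hv hsupp h0
  have hconj : MemLp (fun ω => (starRingEnd ℂ) (G ω)) 2 (haar p) := hGm.star
  -- `v = v₁ - v₂` is supported on `Ω_Σ` and orthogonal to all modulations of `G`
  set v₁ : Vilenkin p → ℂ :=
    B.indicator fun ω => (starRingEnd ℂ) (G (ω - (k : Vilenkin p))) with hv₁
  set v₂ : Vilenkin p → ℂ := fun ω =>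
    B.indicator (fun ω => (starRingEnd ℂ) (G ω)) (ω + (k : Vilenkin p)) with hv₂
  have hm₁ : MemLp v₁ 2 (haar p) := (memLp_comp_sub hconj _).indicator hBm
  have hm₂ : MemLp v₂ 2 (haar p) := by
    have := memLp_comp_sub (hconj.indicator hBm) (-(k : Vilenkin p))
    simpa only [sub_neg_eq_add] using this
  have hv0 : (fun ω => v₁ ω - v₂ ω) =ᵐ[haar p] 0 := by
    refine key (hm₁.sub hm₂) (fun ω hω => ?_) fun n => ?_
    · simp only [hv₁, hv₂]
      rw [Set.indicator_of_notMem fun h => hω (hBS h),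
        Set.indicator_of_notMem fun h => hω (hBS' h), sub_zero]
    · have hint {w : Vilenkin p → ℂ} (hw : MemLp w 2 (haar p)) : Integrable (fun ω =>
          chi (n : Vilenkin p) ω * ((starRingEnd ℂ) (G ω) * w ω)) (haar p) := by
        have := integrable_mul_chi (hconj.integrable_mul hw) (n : Vilenkin p)
        exact this.congr (ae_of_all _ fun ω => mul_comm _ _)
      simp_rw [mul_sub]
      rw [integral_sub (hint hm₁) (hint hm₂), sub_eq_zero,
        ← integral_add_right_eq_self _ (k : Vilenkin p)]
      refine integral_congr_ae (ae_of_all _ fun ω => ?_)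
      simp only [hv₁, hv₂]
      by_cases hω : ω + (k : Vilenkin p) ∈ B
      · rw [Set.indicator_of_mem hω, Set.indicator_of_mem hω, chi_add_right,
          chi_lattice_lattice n.2 k.2, add_sub_cancel_right]
        ring
      · rw [Set.indicator_of_notMem hω, Set.indicator_of_notMem hω]
        ring
  have hG0 : ∀ᵐ ω ∂haar p, ω ∈ B → G ω = 0 := by
    have h2 := (measurePreserving_sub_right (haar p)
      (k : Vilenkin p)).quasiMeasurePreserving.ae hv0
    filter_upwards [h2] with ω h3 hω
    have h4 : ω - (k : Vilenkin p) ∉ B := fun h => hBB h (by rwa [sub_add_cancel])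
    simp only [hv₁, hv₂] at h3
    rw [Set.indicator_of_notMem h4, sub_add_cancel, Set.indicator_of_mem hω] at h3
    simpa using h3
  have hB0 : B.indicator (fun _ => (1 : ℂ)) =ᵐ[haar p] 0 := by
    refine key (memLp_indicator_one hBm hfinB)
      (fun ω hω => Set.indicator_of_notMem (fun h => hω (hBS h)) _) fun n => ?_
    rw [integral_eq_zero_of_ae]
    filter_upwards [hG0] with ω h2
    by_cases hω : ω ∈ B
    · simp [h2 hω]
    · simp [hω]
  rw [measure_eq_zero_iff_ae_notMem]
  filter_upwards [hB0] with ω h2 hω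
  rw [Set.indicator_of_mem hω] at h2
  exact one_ne_zero h2

include ho ht in
theorem isMRA_ladder {φ : Vilenkin p → ℂ} (hφ : IsScalingFunction (ladder hψ2) φ) :
    IsMRA (ladder hψ2) where
  isClosed := isClosed_ladder hψ2
  increasing := monotone_ladder hψ2
  dense_iUnion := dense_iUnion_ladder ho ht
  iInter_eq := iInter_ladder ht
  dilation _ _ hf := memSubspace_ladder_dil hψ2 hf
  translation _ hf := memSubspace_ladder_translate hψ2 hf
  scaling := ⟨φ, hφ⟩

end Scaling

end Vilenkin

theorem theorem2 {p : ℕ} [NeZero p] (hp : 2 ≤ p)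
    (Ω : Vilenkin.Idx p → Set (VilenkinDual p)) (hΩ : Vilenkin.IsWaveletSet Ω)
    (ψ : Vilenkin.Idx p → Vilenkin p → ℂ)
    (hψ : ∀ u, Vilenkin.IsFourierTransform (ψ u) ((Ω u).indicator fun _ => 1)) :
    ((∃ V : ℤ → Submodule ℂ (Vilenkin.L2 p), Vilenkin.IsMRA V ∧ Vilenkin.IsAssociated ψ V) ↔
      ∀ n : Vilenkin.lattice p,
        (n = 0 → Vilenkin.haar p (Vilenkin.sigmaUnion Ω ∩
          (fun ω => ω + (n : VilenkinDual p)) '' Vilenkin.sigmaUnion Ω) = 1) ∧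
        (n ≠ 0 → Vilenkin.haar p (Vilenkin.sigmaUnion Ω ∩
          (fun ω => ω + (n : VilenkinDual p)) '' Vilenkin.sigmaUnion Ω) = 0)) ∧
    ∀ V : ℤ → Submodule ℂ (Vilenkin.L2 p), Vilenkin.IsMRA V → Vilenkin.IsAssociated ψ V →
      ∃ φ : Vilenkin p → ℂ,
        Vilenkin.IsFourierTransform φ ((Vilenkin.sigmaUnion Ω).indicator fun _ => 1) ∧
        Vilenkin.IsScalingFunction V φ ∧
        Vilenkin.IsOrthonormalBasis (V 0)
          (fun (n : Vilenkin.lattice p) x => φ (x - (n : Vilenkin p))) := by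
  open Vilenkin in
  obtain ⟨hm, hfin, hL2, ho', ht'⟩ := hΩ
  have hψ2 (u : Idx p) : MemLp (ψ u) 2 (haar p) := (hψ u).1
  -- the inverse Fourier integrals of the indicators are representatives of the `ψ u`
  have hae (u : Idx p) : ψ u =ᵐ[haar p] invFourierIntegral ((Ω u).indicator fun _ => 1) := by
    refine isFourierTransform_ae_unique (hψ u)
      (isFourierTransform_invFourierIntegral (hm u) (hfin u) ?_)
    have := hL2 (0, 0, u)
    simp only [dilTrans_zero] at this
    simpa using this
  have hb : (fun i => (hL2 i).toLp (dilTrans (invFourierIntegral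
      ((Ω i.2.2).indicator fun _ => 1)) i.1 i.2.1)) = waveletL2 hψ2 := by
    funext i
    exact toLp_eq_toLp_of_ae (dilTrans_ae_eq (hae i.2.2).symm _ _) _ _
  have ho : Orthonormal ℂ (waveletL2 hψ2) := hb ▸ ho'
  have ht : (Submodule.span ℂ (Set.range (waveletL2 hψ2))).topologicalClosure = ⊤ := hb ▸ ht'
  have h1 : haar p (sigmaUnion Ω) = 1 := haar_sigmaUnion hm hfin hψ ho hp
  obtain ⟨φ, hφ⟩ := exists_isFourierTransform
    (memLp_indicator_one (measurableSet_sigmaUnion hm) (h1 ▸ ENNReal.one_lt_top))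
  have hnec (V : ℤ → Submodule ℂ (L2 p)) (hV : IsMRA V) (ha : IsAssociated ψ V)
      (n : lattice p) (hn : n ≠ 0) :
      haar p (sigmaUnion Ω ∩ (fun ω => ω + (n : Vilenkin p)) '' sigmaUnion Ω) = 0 := by
    obtain ⟨φ', hφ2, hspan, -⟩ := hV.scaling
    rw [eq_ladder_of_isAssociated (hψ := hψ2) ho ht hV ha] at hspan
    exact haar_sigmaUnion_inter_translate hm hfin hψ ho ht h1 hφ2 hspan hn
  refine ⟨⟨?_, fun h => ?_⟩, fun V hV ha => ?_⟩
  · rintro ⟨V, hV, ha⟩ n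
    refine ⟨?_, hnec V hV ha n⟩
    rintro rfl
    simpa using h1
  · have honb := isOrthonormalBasis_translates hm hfin hψ ho ht h1 (fun n => (h n).2) hφ
    exact ⟨ladder hψ2, isMRA_ladder ho ht honb.isRieszBasis, isAssociated_ladder ho ht⟩
  · have honb := isOrthonormalBasis_translates hm hfin hψ ho ht h1 (hnec V hV ha) hφ
    rw [← eq_ladder_of_isAssociated (hψ := hψ2) ho ht hV ha] at honb
    exact ⟨φ, hφ, honb.isRieszBasis, honb⟩
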